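/- Let $R$ be a finite commutative chain ring (a finite commutative local ring whose ideals are totally ordered by inclusion) of characteristic $p^k$, $p$ prime, with maximal ideal $\langle\gamma\rangle$, let $s$ be the nilpotency index of $\gamma$ (so $\gamma^s=0$ and $\gamma^i\ne0$ for $i<s$), and let $q$ be the size of the residue field $R/\langle\gamma\rangle$. Let $n$ be a positive integer with $\gcd(p,n)=1$, and let $R[D_{2n}]$ be the group ring of $D_{2n}=\langle x,y\mid x^n=y^2=1,\ yx=x^{-1}y\rangle$, which contains $S=R[x]/\langle x^n-1\rangle$. For a factor $h$ of $x^n-1$ let $h^*$ be its reciprocal $x^{\deg h}h(1/x)$ divided by the unit $h(0)$, so that $h^*$ is monic. Write $$x^n-1=f_1\cdots f_r\cdot(g_{r+1}g_{r+1}^*)\cdots(g_{r+w}g_{r+w}^*)$$ with $f_i,g_i$ monic and irreducible over $R$, $f_i^*=f_i$ and $g_i^*\neq g_i$. For a monic factor $h$ of $x^n-1$ let $A_h\subseteq S$ be the ideal generated by $(x^n-1)/h$; it is a ring whose identity is the class of $a\cdot(x^n-1)/h$, where $a\cdot(x^n-1)/h+b\cdot h=1$ with $a,b\in R[x]$. Let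 $A_i=A_{f_i}$ with identity $E_i$ for $1\le i\le r$, and let $E_{i_1}$ and $E_{i_2}$ be the identities of $A_{i_1}=A_{g_i}$ and $A_{i_2}=A_{g_i^*}$ for $r+1\le i\le r+w$. Below, $\langle\cdot\rangle$ denotes the left ideal of $R[D_{2n}]$ generated by the given elements. Every left ideal $C$ of $R[D_{2n}]$ is a direct sum $C=\bigoplus_{i=1}^{r+w}C_i$ of left ideals $C_i$, where A) for $1\le i\le r$, $C_i$ is of one of the following forms: A1) $C_i=\langle\gamma^{b_i}E_i\rangle$ with $0\le b_i\le s$; A2) $C_i=\langle\gamma^{a_i}E_i\,(y+r_i(x)),\ \gamma^{b_i}E_i\rangle$ with $0\le a_i<b_i\le s$ and $r_i(x)$ a unit of $A_i$ such that $r_i(x)r_i(x^{-1})\equiv E_i \pmod{\gamma^{b_i-a_i}A_i}$; B) for $r+1\le i\le r+w$, $C_i$ is of one of the following forms: B1) $C_i=\langle\gamma^{a_i}E_{i_1}+\gamma^{c_i}E_{i_2}\rangle$ with $0\le a_i,c_i\le s$; B2) $C_i=\langle\gamma^{a_i}E_{i_1}+\gamma^{c_i}E_{i_2}+\gamma^{b_i}\alpha_i(x)\,y\rangle$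 with $0\le a_i\le s-1$, $1\le c_i\le s$, $\max\{0,a_i+c_i-s\}\le b_i\le c_i-1$, and $\alpha_i(x)\in A_{i_1}$ a unit modulo $\gamma^{c_i-b_i}A_{i_1}$. Moreover, for all parameters satisfying the stated conditions, the left ideals displayed have cardinality $q^{2\deg(f_i)(s-b_i)}$ in A1), $q^{\deg(f_i)(2s-a_i-b_i)}$ in A2), and $q^{2\deg(g_i)(2s-a_i-c_i)}$ in B1) and in B2). -/

import Mathlib

open Polynomial

namespace DihedralCode

section

variable {R : Type*} [CommRing R]

/-- The reciprocal `x ^ deg f * f (1 / x)` of `f`, divided by its leading coefficient `f 0`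
so that it is monic. (It is used for factors of `x ^ n - 1`, for which `f 0` is a unit.) -/
noncomputable def recip (f : R[X]) : R[X] :=
  C (Ring.inverse (f.coeff 0)) * f.reverse

variable (R) in
/-- The ring `S = R[x] / (x ^ n - 1)`. -/
abbrev CycRing (n : ℕ) : Type _ := R[X] ⧸ Ideal.span {(X ^ n - 1 : R[X])}

/-- The class of a polynomial in `S`. -/
noncomputable abbrev toS (n : ℕ) (f : R[X]) : CycRing R n :=
  Ideal.Quotient.mk (Ideal.span {(X ^ n - 1 : R[X])}) f

/-- The complementary factor `(x ^ n - 1) / f` of a monic factor `f`. -/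
noncomputable def cofactor (n : ℕ) (f : R[X]) : R[X] := (X ^ n - 1) /ₘ f

/-- The ideal of `S` generated by `(x ^ n - 1) / f`. -/
noncomputable def component (n : ℕ) (f : R[X]) : Ideal (CycRing R n) :=
  Ideal.span {toS n (cofactor n f)}

open Classical in
/-- The identity element of `component n f`, namely the class of `a * ((x ^ n - 1) / f)`, where
`a * ((x ^ n - 1) / f) + b * f = 1`. It does not depend on `a` and `b`. -/
noncomputable def idem (n : ℕ) (f : R[X]) : CycRing R n :=
  if h : IsCoprime (cofactor n f) f then toS n (h.choose * cofactor n f) else 0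

theorem toS_X_pow (n : ℕ) : (toS n (X : R[X])) ^ n = 1 := by
  have h : toS n (X ^ n - 1 : R[X]) = 0 :=
    Ideal.Quotient.eq_zero_iff_mem.2 (Ideal.mem_span_singleton_self _)
  rwa [toS, map_sub, map_pow, map_one, sub_eq_zero] at h

/-- The `R`-algebra endomorphism `a(x) ↦ a(x⁻¹)` of `S`, where `x⁻¹ = x ^ (n - 1)`. -/
noncomputable def conj (n : ℕ) : CycRing R n →ₐ[R] CycRing R n :=
  Ideal.Quotient.liftₐ _ (aeval (toS n (X : R[X]) ^ (n - 1))) (by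
    intro a ha
    obtain ⟨b, rfl⟩ := Ideal.mem_span_singleton.1 ha
    have h : (toS n (X : R[X]) ^ (n - 1)) ^ n = 1 := by
      rw [← pow_mul, mul_comm, pow_mul, toS_X_pow, one_pow]
    simp only [map_mul, map_sub, map_pow, map_one, aeval_X, h, sub_self, zero_mul])

variable (R) in
/-- The dihedral group ring `R[D_{2n}]`. The left ideals of this noncommutative ring are the
terms of type `Ideal (DihRing R n)`, and `Ideal.span` is the generated left ideal. -/
abbrev DihRing (n : ℕ) : Type _ := MonoidAlgebra R (DihedralGroup n)

variable (R) in
/-- The generator `x` of order `n`, in the group ring. -/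
noncomputable def genX (n : ℕ) : DihRing R n := MonoidAlgebra.of R _ (DihedralGroup.r 1)

variable (R) in
/-- The generator `y` of order `2`, in the group ring. -/
noncomputable def genY (n : ℕ) : DihRing R n := MonoidAlgebra.of R _ (DihedralGroup.sr 0)

theorem genX_pow (n : ℕ) : genX R n ^ n = 1 := by
  rw [genX, ← map_pow, DihedralGroup.r_one_pow_n, map_one]

theorem genY_sq (n : ℕ) : genY R n ^ 2 = 1 := by
  rw [genY, ← map_pow, sq, DihedralGroup.sr_mul_self, map_one]

/-- The relation `x (y x) = y`, that is `y x = x⁻¹ y`. -/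
theorem genX_genY_genX (n : ℕ) : genX R n * (genY R n * genX R n) = genY R n := by
  simp [genX, genY]

/-- The embedding of `S` in `R[D_{2n}]` that sends `x` to `x`. -/
noncomputable def emb (n : ℕ) : CycRing R n →ₐ[R] DihRing R n :=
  Ideal.Quotient.liftₐ _ (aeval (genX R n)) (by
    intro a ha
    obtain ⟨b, rfl⟩ := Ideal.mem_span_singleton.1 ha
    simp only [map_mul, map_sub, map_pow, map_one, aeval_X, genX_pow, sub_self, zero_mul])

/-- The factorization `x ^ n - 1 = f_1 ⋯ f_r (g_1 g_1^*) ⋯ (g_w g_w^*)` into monic irreducible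
polynomials, the `f_i` being self-reciprocal and the `g_j` not. -/
structure IsFactorization (n : ℕ) {r w : ℕ} (f : Fin r → R[X]) (g : Fin w → R[X]) : Prop where
  prod_eq : (X ^ n - 1 : R[X]) = (∏ i, f i) * ∏ j, (g j * recip (g j))
  monic_f : ∀ i, (f i).Monic
  irreducible_f : ∀ i, Irreducible (f i)
  recip_f : ∀ i, recip (f i) = f i
  monic_g : ∀ j, (g j).Monic
  irreducible_g : ∀ j, Irreducible (g j)
  recip_g : ∀ j, recip (g j) ≠ g j

/-- `u` is an element of `component n f` that is a unit modulo `γ ^ m`. -/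
def IsUnitMod (γ : R) (n : ℕ) (f : R[X]) (m : ℕ) (u : CycRing R n) : Prop :=
  u ∈ component n f ∧
    ∃ v ∈ component n f, ∃ z ∈ component n f, u * v = idem n f + γ ^ m • z

/-- `u` is a unit of the ring `component n f`, whose identity is `idem n f`. -/
def IsUnitIn (n : ℕ) (f : R[X]) (u : CycRing R n) : Prop :=
  u ∈ component n f ∧ ∃ v ∈ component n f, u * v = idem n f

/-- The left ideal generated by `γ ^ b E`, with `E` the idempotent of `f`. -/
noncomputable def codeA1 (γ : R) (n : ℕ) (f : R[X]) (b : ℕ) : Ideal (DihRing R n) :=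
  Ideal.span {γ ^ b • emb n (idem n f)}

/-- The left ideal generated by `γ ^ a E (y + u)` and `γ ^ b E`. -/
noncomputable def codeA2 (γ : R) (n : ℕ) (f : R[X]) (a b : ℕ) (u : CycRing R n) :
    Ideal (DihRing R n) :=
  Ideal.span {γ ^ a • (emb n (idem n f) * (genY R n + emb n u)), γ ^ b • emb n (idem n f)}

/-- The conditions on the parameters of `codeA2`: `0 ≤ a < b ≤ s`, and `u` is a unit of
`component n f` with `u(x) u(x⁻¹) ≡ E` modulo `γ ^ (b - a)`. -/
def AdmissibleA2 (γ : R) (s n : ℕ) (f : R[X]) (a b : ℕ) (u : CycRing R n) : Prop :=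
  a < b ∧ b ≤ s ∧ IsUnitIn n f u ∧
    ∃ z ∈ component n f, u * conj n u = idem n f + γ ^ (b - a) • z

/-- The left ideal generated by `γ ^ a E₁ + γ ^ c E₂`, with `E₁` and `E₂` the idempotents of `g`
and of its reciprocal. -/
noncomputable def codeB1 (γ : R) (n : ℕ) (g : R[X]) (a c : ℕ) : Ideal (DihRing R n) :=
  Ideal.span {γ ^ a • emb n (idem n g) + γ ^ c • emb n (idem n (recip g))}

/-- The left ideal generated by `γ ^ a E₁ + γ ^ c E₂ + γ ^ b α y`. -/
noncomputable def codeB2 (γ : R) (n : ℕ) (g : R[X]) (a b c : ℕ) (α : CycRing R n) :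
    Ideal (DihRing R n) :=
  Ideal.span {γ ^ a • emb n (idem n g) + γ ^ c • emb n (idem n (recip g)) +
    γ ^ b • emb n α * genY R n}

/-- The conditions on the parameters of `codeB2`: `0 ≤ a ≤ s - 1`, `1 ≤ c ≤ s`,
`max {0, a + c - s} ≤ b ≤ c - 1`, and `α` is a unit of `component n g` modulo `γ ^ (c - b)`. -/
def AdmissibleB2 (γ : R) (s n : ℕ) (g : R[X]) (a b c : ℕ) (α : CycRing R n) : Prop :=
  a < s ∧ 1 ≤ c ∧ c ≤ s ∧ a + c ≤ b + s ∧ b < c ∧ IsUnitMod γ n g (c - b) α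

/-- The Bézout relation that `idem` uses is available for every monic factor of `x ^ n - 1`. -/
theorem isCoprime_cofactor {p k n : ℕ} [CharP R (p ^ k)] (hpn : Nat.Coprime p n) {f : R[X]}
    (hf : f.Monic) (hfn : f ∣ X ^ n - 1) : IsCoprime (cofactor n f) f := by
  have hn : IsUnit (n : R) := by
    have h : IsCoprime (n : ℤ) ((p ^ k : ℕ) : ℤ) :=
      Nat.isCoprime_iff_coprime.2 (hpn.symm.pow_right k)
    obtain ⟨a, b, hab⟩ := h
    have h2 := congrArg (Int.cast : ℤ → R) hab
    simp only [Int.cast_add, Int.cast_mul, Int.cast_natCast, CharP.cast_eq_zero, mul_zero,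
      add_zero, Int.cast_one] at h2
    exact IsUnit.of_mul_eq_one (a : R) (by rw [mul_comm]; exact h2)
  have hs : (X ^ n - 1 : R[X]).Separable := by
    have := separable_X_pow_sub_C_unit (1 : Rˣ) hn
    simpa using this
  have hd : f * cofactor n f = X ^ n - 1 := by
    have := modByMonic_add_div (X ^ n - 1) f
    rwa [(modByMonic_eq_zero_iff_dvd hf).2 hfn, zero_add] at this
  rw [← hd] at hs
  exact hs.isCoprime.symm

/-- `idem n f` is the identity element of `component n f`. -/
theorem idem_spec {n : ℕ} {f : R[X]} (hf : f.Monic) (hfn : f ∣ X ^ n - 1)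
    (h : IsCoprime (cofactor n f) f) :
    idem n f ∈ component n f ∧ ∀ a ∈ component n f, idem n f * a = a := by
  have hd : f * cofactor n f = X ^ n - 1 := by
    have := modByMonic_add_div (X ^ n - 1) f
    rwa [(modByMonic_eq_zero_iff_dvd hf).2 hfn, zero_add] at this
  rw [idem, dif_pos h]
  constructor
  · rw [toS, map_mul]
    exact Ideal.mul_mem_left _ _ (Ideal.mem_span_singleton_self _)
  · intro a ha
    obtain ⟨b, rfl⟩ := Ideal.mem_span_singleton.1 ha
    obtain ⟨v, hv⟩ := h.choose_spec
    rw [← mul_assoc]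
    congr 1
    rw [toS, toS, ← map_mul, Ideal.Quotient.eq, ← hd]
    refine Ideal.mem_span_singleton.2 ⟨-v, ?_⟩
    linear_combination cofactor n f * hv

end

end DihedralCode

/-!
Let `S = R[x] / (x ^ n - 1)`, let `σ` be the involution `x ↦ x⁻¹` of `S`, and regard `R[D_{2n}]` as
the free `S`-module on `1`, `y` with `y a = σ(a) y` and `y ^ 2 = 1`. Since `x ^ n - 1` is separable
modulo `γ`, its monic factors give a complete orthogonal family of idempotents of `S`. The
idempotents `E` of the self-reciprocal `f_i` and the sums `E₁ + E₂` belonging to the pairs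
`g_j`, `g_j^*` are fixed by `σ`, hence central in the group ring, and every left ideal splits along
them (`exists_iSupIndep_of_central_idempotents`).

By Hensel lifting (`exists_factor_lift`) a factor that is irreducible over `R` stays irreducible over
the residue field, so the corresponding component `E S` is again a chain ring with maximal ideal
generated by `γ E` (`IsCoprimeFactor.isChainIdem`). Its ideals are the `s + 1` powers of that ideal,
here called levels, of sizes `Q ^ (s - i)` with `Q = q ^ deg f` (`IsChainIdem.card_level_of_card`).

* In a self-reciprocal block, a left ideal `C` is described by the ideal `γ ^ a E S` of all
  coefficients of `y`, the ideal `γ ^ b E S` of its elements without `y`, and an element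
  `γ ^ a (u + y)` in it. Multiplication by `y` shows `a ≤ b` and `u σ(u) ≡ E` modulo `γ ^ (b - a)`
  (`IsDihedralExt.exists_eq_codeA`).
* In the block of a reciprocal pair, `σ` exchanges `E₁` and `E₂ = σ(E₁)`, so `C = N + y N` where
  `N = E₁ C` is an arbitrary submodule of the free module of rank `2` over the chain ring `E₁ S`.
  Such an `N` is generated by `γ ^ a + γ ^ b α y` and `γ ^ c y` (`IsDihedralExt.exists_eq_codeB`).

In both cases an explicit parametrization of the left ideal by levels gives its size.
-/

/-! ### Idempotents that cut out a chain ring -/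

namespace DihedralCode

section ChainIdempotent

variable {S : Type*} [CommRing S]

/-- `E` is an idempotent of `S` and the ring `E S` is a chain ring with maximal ideal generated
by `t E`, where `s` is the nilpotency index of `t E`. -/
structure IsChainIdem (t E : S) (s : ℕ) : Prop where
  idem : E * E = E
  pow_mul : t ^ s * E = 0
  pow_ne : ∀ m < s, t ^ m * E ≠ 0
  unit_or : ∀ a, (∃ v, a * v * E = E) ∨ ∃ c, a * E = t * c * E

/-- The ideal `t ^ i E S`, one of the `s + 1` ideals of the chain ring `E S`. -/
def level (t E : S) (i : ℕ) : Ideal S := Ideal.span {t ^ i * E}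

theorem mem_level {t E : S} {i : ℕ} {x : S} : x ∈ level t E i ↔ ∃ a, x = t ^ i * a * E := by
  rw [level, Ideal.mem_span_singleton]
  exact ⟨fun ⟨a, h⟩ => ⟨a, by rw [h]; ring⟩, fun ⟨a, h⟩ => ⟨a, by rw [h]; ring⟩⟩

theorem level_anti (t E : S) {i j : ℕ} (h : i ≤ j) : level t E j ≤ level t E i := by
  intro x hx
  obtain ⟨a, rfl⟩ := mem_level.1 hx
  refine mem_level.2 ⟨t ^ (j - i) * a, ?_⟩
  rw [← mul_assoc, ← pow_add, Nat.add_sub_cancel' h]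

namespace IsChainIdem

variable {t E : S} {s : ℕ} (h : IsChainIdem t E s)
include h

theorem mul_idem_of_mem {i : ℕ} {x : S} (hx : x ∈ level t E i) : x * E = x := by
  obtain ⟨a, rfl⟩ := mem_level.1 hx
  rw [mul_assoc, h.idem]

/-- Every element of a chain ring is a power of the generator of the maximal ideal times a unit. -/
theorem exists_eq_pow_mul_unit (a : S) :
    ∃ i ≤ s, ∃ u v, a * E = t ^ i * u ∧ u * E = u ∧ v * E = v ∧ u * v = E := by
  suffices H : ∀ m ≤ s, (∃ i ≤ s, ∃ u v, a * E = t ^ i * u ∧ u * E = u ∧ v * E = v ∧ u * v = E) ∨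
      ∃ c, a * E = t ^ m * c * E by
    obtain H | ⟨c, hc⟩ := H s le_rfl
    · exact H
    · refine ⟨s, le_rfl, E, E, ?_, h.idem, h.idem, h.idem⟩
      rw [hc, h.pow_mul, mul_right_comm, h.pow_mul, zero_mul]
  intro m
  induction m with
  | zero => exact fun _ => Or.inr ⟨a, by simp⟩
  | succ m ih =>
    intro hm
    obtain H | ⟨c, hc⟩ := ih (by omega)
    · exact Or.inl H
    · obtain ⟨v, hv⟩ | ⟨d, hd⟩ := h.unit_or c
      · refine Or.inl ⟨m, by omega, c * E, v * E, by rw [hc, mul_assoc], ?_, ?_, ?_⟩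
        · rw [mul_assoc, h.idem]
        · rw [mul_assoc, h.idem]
        · linear_combination hv + c * v * h.idem
      · exact Or.inr ⟨d, by rw [hc, pow_succ]; linear_combination t ^ m * hd⟩

theorem pow_mul_eq_zero_iff {m : ℕ} : t ^ m * E = 0 ↔ s ≤ m := by
  refine ⟨fun hm => not_lt.1 fun hlt => h.pow_ne m hlt hm, fun hm => ?_⟩
  rw [← Nat.add_sub_cancel' hm, pow_add, mul_right_comm, h.pow_mul, zero_mul]

theorem mem_level_of_pow_mul_eq_zero {i : ℕ} {a : S} (ha : a * E = a) (h0 : t ^ i * a = 0) :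
    a ∈ level t E (s - i) := by
  obtain ⟨j, -, u, v, hau, huE, -, huv⟩ := h.exists_eq_pow_mul_unit a
  rw [ha] at hau
  have : t ^ (i + j) * E = 0 := by
    rw [pow_add]
    linear_combination v * h0 - t ^ i * v * hau - t ^ i * t ^ j * huv
  have hij := h.pow_mul_eq_zero_iff.1 this
  refine level_anti t E (show s - i ≤ j by omega) (mem_level.2 ⟨u, ?_⟩)
  rw [hau, mul_assoc, huE]

theorem mem_level_of_pow_mul_mem {i j : ℕ} {a : S} (ha : a * E = a) (hij : i ≤ j) (hjs : j ≤ s)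
    (h0 : t ^ i * a ∈ level t E j) : a ∈ level t E (j - i) := by
  obtain ⟨c, hc⟩ := mem_level.1 h0
  have h1 : a - t ^ (j - i) * c * E ∈ level t E (s - i) := by
    refine h.mem_level_of_pow_mul_eq_zero (i := i) ?_ ?_
    · rw [sub_mul, ha, mul_assoc _ E E, h.idem]
    · rw [mul_sub, hc, ← mul_assoc, ← mul_assoc, ← pow_add, Nat.add_sub_cancel' hij, sub_self]
  have h2 := level_anti t E (show j - i ≤ s - i by omega) h1
  have h3 := (level t E (j - i)).add_mem h2 (mem_level.2 ⟨c, rfl⟩)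
  rwa [sub_add_cancel] at h3

theorem exists_eq_level {I : Ideal S} (hI : ∀ x ∈ I, x * E = x) : ∃ i ≤ s, I = level t E i := by
  classical
  have hex : ∃ i, t ^ i * E ∈ I := ⟨s, by rw [h.pow_mul]; exact I.zero_mem⟩
  refine ⟨Nat.find hex, Nat.find_min' hex (by rw [h.pow_mul]; exact I.zero_mem),
    le_antisymm (fun a ha => ?_) ?_⟩
  · obtain ⟨j, -, u, v, hau, huE, -, huv⟩ := h.exists_eq_pow_mul_unit a
    rw [hI a ha] at hau
    have hj : t ^ j * E ∈ I := by
      have := I.mul_mem_left v ha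
      rwa [hau, show v * (t ^ j * u) = t ^ j * (u * v) by ring, huv] at this
    exact level_anti t E (Nat.find_min' hex hj) (mem_level.2 ⟨u, by rw [hau, mul_assoc, huE]⟩)
  · rw [level, Ideal.span_singleton_le_iff_mem]
    exact Nat.find_spec hex

/-- The quotients of consecutive levels all have the size of the residue field. -/
theorem relIndex_level {i : ℕ} (hi : i < s) :
    (level t E (i + 1)).toAddSubgroup.relIndex (level t E i).toAddSubgroup =
      (level t E 1).toAddSubgroup.relIndex (level t E 0).toAddSubgroup := by
  have hmap : (level t E 0).toAddSubgroup.map (AddMonoidHom.mulLeft (t ^ i)) =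
      (level t E i).toAddSubgroup := by
    ext x
    simp only [AddSubgroup.mem_map, Submodule.mem_toAddSubgroup, AddMonoidHom.coe_mulLeft]
    constructor
    · rintro ⟨a, ha, rfl⟩
      exact mem_level.2 ⟨a, by rw [mul_assoc, h.mul_idem_of_mem ha]⟩
    · intro hx
      obtain ⟨a, rfl⟩ := mem_level.1 hx
      exact ⟨a * E, mem_level.2 ⟨a, by simp⟩, by rw [mul_assoc]⟩
  have hcomap : (level t E (i + 1)).toAddSubgroup.comap (AddMonoidHom.mulLeft (t ^ i)) ⊓
      (level t E 0).toAddSubgroup = (level t E 1).toAddSubgroup := by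
    ext x
    simp only [AddSubgroup.mem_inf, AddSubgroup.mem_comap, Submodule.mem_toAddSubgroup,
      AddMonoidHom.coe_mulLeft]
    constructor
    · rintro ⟨h1, h2⟩
      have := h.mem_level_of_pow_mul_mem (h.mul_idem_of_mem h2) (Nat.le_succ i) hi h1
      rwa [Nat.succ_sub le_rfl, Nat.sub_self] at this
    · intro hx
      refine ⟨?_, level_anti t E zero_le_one hx⟩
      obtain ⟨a, rfl⟩ := mem_level.1 hx
      exact mem_level.2 ⟨a, by ring⟩
  rw [← hmap, ← AddSubgroup.relIndex_comap, ← AddSubgroup.inf_relIndex_right, hcomap]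

theorem card_level {i : ℕ} (hi : i ≤ s) :
    Nat.card (level t E i) =
      (level t E 1).toAddSubgroup.relIndex (level t E 0).toAddSubgroup ^ (s - i) := by
  induction hi using Nat.decreasingInduction with
  | self =>
    have : level t E s = ⊥ := by rw [level, h.pow_mul, Ideal.span_singleton_eq_bot]
    rw [this, Nat.sub_self, pow_zero]
    exact Nat.card_unique
  | of_succ i hi ih =>
    have h1 : Nat.card (level t E i) = Nat.card (level t E (i + 1)) *
        (level t E (i + 1)).toAddSubgroup.relIndex (level t E i).toAddSubgroup := by
      change Nat.card (level t E i).toAddSubgroup = Nat.card (level t E (i + 1)).toAddSubgroup * _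
      rw [← AddSubgroup.relIndex_bot_left, ← AddSubgroup.relIndex_bot_left]
      exact (AddSubgroup.relIndex_mul_relIndex _ _ _ bot_le
        (fun x hx => level_anti t E (Nat.le_succ i) hx)).symm
    rw [h1, ih, h.relIndex_level hi, ← pow_succ]
    congr 1
    omega

/-- The sizes of all levels are determined by the size `Q ^ s` of the chain ring. -/
theorem card_level_of_card {Q i : ℕ} (hs : s ≠ 0) (hQ : Nat.card (level t E 0) = Q ^ s)
    (hi : i ≤ s) : Nat.card (level t E i) = Q ^ (s - i) := by
  have h0 := h.card_level (Nat.zero_le s)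
  rw [hQ, Nat.sub_zero] at h0
  rw [h.card_level hi, Nat.pow_left_injective hs h0]

end IsChainIdem

end ChainIdempotent

end DihedralCode

/-! ### Left ideals in a block fixed by the involution -/

namespace DihedralCode

section DihedralExtension

variable {S B : Type*} [CommRing S] [Ring B]

/-- The element `a + b y` of a ring `B` that contains `S` through `ι`. -/
def elt (ι : S →+* B) (y : B) (a b : S) : B := ι a + ι b * y

/-- `B` is free over the commutative ring `S` with basis `1`, `y`, where `y ^ 2 = 1` and
`y a = σ(a) y` for an involution `σ` of `S`. -/
structure IsDihedralExt (ι : S →+* B) (σ : S →+* S) (y : B) : Prop where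
  y_mul : ∀ a, y * ι a = ι (σ a) * y
  y_sq : y * y = 1
  invol : ∀ a, σ (σ a) = a
  bij : Function.Bijective fun v : S × S => elt ι y v.1 v.2

/-- The left ideal generated by `t ^ a E (y + u)` and `t ^ b E`. -/
def codeA (ι : S →+* B) (y : B) (t E : S) (a b : ℕ) (u : S) : Ideal B :=
  Ideal.span {elt ι y (t ^ a * E * u) (t ^ a * E), elt ι y (t ^ b * E) 0}

/-- The left ideal generated by `t ^ a E + t ^ c σ(E) + t ^ b α y`. -/
def codeB (ι : S →+* B) (σ : S →+* S) (y : B) (t E : S) (a b c : ℕ) (α : S) : Ideal B :=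
  Ideal.span {elt ι y (t ^ a * E + t ^ c * σ E) (t ^ b * α)}

theorem elt_add (ι : S →+* B) (y : B) (a b a' b' : S) :
    elt ι y a b + elt ι y a' b' = elt ι y (a + a') (b + b') := by
  simp only [elt, map_add, add_mul]; abel

theorem elt_sub (ι : S →+* B) (y : B) (a b a' b' : S) :
    elt ι y a b - elt ι y a' b' = elt ι y (a - a') (b - b') := by
  simp only [elt, map_sub, sub_mul]; abel

theorem mul_elt (ι : S →+* B) (y : B) (p a b : S) :
    ι p * elt ι y a b = elt ι y (p * a) (p * b) := by
  simp only [elt, map_mul, mul_add, mul_assoc]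

theorem elt_zero (ι : S →+* B) (y : B) : elt ι y 0 0 = 0 := by simp [elt]

namespace IsDihedralExt

variable {ι : S →+* B} {σ : S →+* S} {y : B} (d : IsDihedralExt ι σ y)
include d

theorem y_mul_elt (a b : S) : y * elt ι y a b = elt ι y (σ b) (σ a) := by
  simp only [elt, mul_add]
  rw [d.y_mul, ← mul_assoc, d.y_mul, mul_assoc _ y y, d.y_sq, mul_one, add_comm]

theorem exists_elt (z : B) : ∃ a b, z = elt ι y a b := by
  obtain ⟨⟨a, b⟩, h⟩ := d.bij.2 z
  exact ⟨a, b, h.symm⟩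

theorem elt_inj {a b a' b' : S} (h : elt ι y a b = elt ι y a' b') : a = a' ∧ b = b' := by
  simpa using d.bij.1 (a₁ := (a, b)) (a₂ := (a', b')) h

theorem elt_mul_elt (p q a b : S) :
    elt ι y p q * elt ι y a b = elt ι y (p * a + q * σ b) (p * b + q * σ a) := by
  conv_lhs => rw [elt]
  rw [add_mul, mul_elt, mul_assoc, d.y_mul_elt, mul_elt, elt_add]

variable {t E : S} {s : ℕ} (h : IsChainIdem t E s) (hσt : σ t = t)
include h hσt

section SelfConjugate

variable (hσE : σ E = E)
include hσE

omit d h in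
theorem conj_mem_level {i : ℕ} {x : S} (hx : x ∈ level t E i) : σ x ∈ level t E i := by
  obtain ⟨a, rfl⟩ := mem_level.1 hx
  exact mem_level.2 ⟨σ a, by rw [map_mul, map_mul, map_pow, hσE, hσt]⟩

/-- The parameters `x` and `e` are uniquely determined by `z`, which gives the size of `codeA`. -/
theorem mem_codeA {a b : ℕ} {u : S} (hab : a ≤ b)
    (huu : E - u * σ u ∈ level t E (b - a)) {z : B} :
    z ∈ codeA ι y t E a b u ↔
      ∃ x ∈ level t E a, ∃ e ∈ level t E b, z = elt ι y (x * u + e) x := by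
  constructor
  · intro hz
    induction hz using Submodule.span_induction with
    | mem z hz =>
      obtain rfl | rfl := hz
      · exact ⟨t ^ a * E, mem_level.2 ⟨1, by ring⟩, 0, Ideal.zero_mem _, by rw [add_zero]⟩
      · exact ⟨0, Ideal.zero_mem _, t ^ b * E, mem_level.2 ⟨1, by ring⟩,
          by rw [zero_mul, zero_add]⟩
    | zero => exact ⟨0, Ideal.zero_mem _, 0, Ideal.zero_mem _, by simp [elt_zero]⟩
    | add z z' _ _ hz hz' =>
      obtain ⟨x, hx, e, he, rfl⟩ := hz
      obtain ⟨x', hx', e', he', rfl⟩ := hz'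
      refine ⟨x + x', add_mem hx hx', e + e', add_mem he he', ?_⟩
      rw [elt_add]; congr 1; ring
    | smul r z _ hz =>
      obtain ⟨x, hx, e, he, rfl⟩ := hz
      obtain ⟨p, q, rfl⟩ := d.exists_elt r
      have hσx := conj_mem_level hσt hσE hx
      have hσe := conj_mem_level hσt hσE he
      refine ⟨p * x + q * (σ x * σ u + σ e), ?_,
        p * e + q * (σ x * (E - u * σ u) - σ e * u), ?_, ?_⟩
      · exact add_mem (Ideal.mul_mem_left _ _ hx) (Ideal.mul_mem_left _ _
          (add_mem (Ideal.mul_mem_right _ _ hσx) (level_anti t E hab hσe)))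
      · refine add_mem (Ideal.mul_mem_left _ _ he) (Ideal.mul_mem_left _ _
          (sub_mem ?_ (Ideal.mul_mem_right _ _ hσe)))
        obtain ⟨f, hf⟩ := mem_level.1 hσx
        obtain ⟨g, hg⟩ := mem_level.1 huu
        refine mem_level.2 ⟨f * E * g, ?_⟩
        rw [hf, hg, ← Nat.add_sub_cancel' hab, pow_add, Nat.add_sub_cancel_left]
        ring
      · have hx' := h.mul_idem_of_mem hσx
        rw [smul_eq_mul, d.elt_mul_elt]
        congr 1
        · linear_combination -q * hx'
        · rw [map_add, map_mul]
  · rintro ⟨x, hx, e, he, rfl⟩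
    obtain ⟨f, rfl⟩ := mem_level.1 hx
    obtain ⟨g, rfl⟩ := mem_level.1 he
    have h1 : elt ι y (t ^ a * f * E * u + t ^ b * g * E) (t ^ a * f * E) =
        ι f * elt ι y (t ^ a * E * u) (t ^ a * E) + ι g * elt ι y (t ^ b * E) 0 := by
      rw [mul_elt, mul_elt, elt_add]; congr 1 <;> ring
    rw [h1]
    exact add_mem (Ideal.mul_mem_left _ _ (Ideal.subset_span (by simp)))
      (Ideal.mul_mem_left _ _ (Ideal.subset_span (by simp)))

theorem card_codeA {a b Q : ℕ} {u : S} (hs : s ≠ 0) (hQ : Nat.card (level t E 0) = Q ^ s)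
    (hab : a ≤ b) (hbs : b ≤ s) (huu : E - u * σ u ∈ level t E (b - a)) :
    Nat.card (codeA ι y t E a b u) = Q ^ (2 * s - a - b) := by
  have hmem := @mem_codeA _ _ _ _ _ _ _ d _ _ _ h hσt hσE _ _ _ hab huu
  let F : level t E a × level t E b → codeA ι y t E a b u := fun v =>
    ⟨elt ι y (v.1 * u + v.2) v.1, hmem.2 ⟨_, v.1.2, _, v.2.2, rfl⟩⟩
  have hF : Function.Bijective F := by
    constructor
    · rintro ⟨⟨x, hx⟩, ⟨e, he⟩⟩ ⟨⟨x', hx'⟩, ⟨e', he'⟩⟩ hv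
      obtain ⟨h1, h2⟩ := d.elt_inj (Subtype.ext_iff.1 hv)
      simp only at h1 h2
      subst h2
      simpa using h1
    · rintro ⟨z, hz⟩
      obtain ⟨x, hx, e, he, rfl⟩ := hmem.1 hz
      exact ⟨(⟨x, hx⟩, ⟨e, he⟩), rfl⟩
  rw [← Nat.card_congr (Equiv.ofBijective F hF), Nat.card_prod,
    h.card_level_of_card hs hQ (hab.trans hbs), h.card_level_of_card hs hQ hbs, ← pow_add]
  congr 1
  omega

theorem exists_eq_codeA {C : Ideal B} (hC : ∀ z ∈ C, ι E * z = z) :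
    (∃ b ≤ s, C = codeA ι y t E b b 0) ∨
      ∃ a b u, a < b ∧ b ≤ s ∧ u * E = u ∧ (∃ v, v * E = v ∧ u * v = E) ∧
        (E - u * σ u ∈ level t E (b - a)) ∧ C = codeA ι y t E a b u := by
  -- The constant terms of `C` and the coefficients of `y` both form ideals of the chain ring.
  let I : Ideal S :=
    { carrier := {x | ∃ e, elt ι y e x ∈ C}
      add_mem' := by
        rintro x x' ⟨e, he⟩ ⟨e', he'⟩
        exact ⟨e + e', by rw [← elt_add]; exact add_mem he he'⟩
      zero_mem' := ⟨0, by rw [elt_zero]; exact C.zero_mem⟩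
      smul_mem' := by
        rintro p x ⟨e, he⟩
        exact ⟨p * e, by rw [smul_eq_mul, ← mul_elt]; exact C.mul_mem_left _ he⟩ }
  let J : Ideal S :=
    { carrier := {e | elt ι y e 0 ∈ C}
      add_mem' := by
        intro e e' he he'
        have := C.add_mem he he'
        rwa [elt_add, add_zero] at this
      zero_mem' := by change elt ι y 0 0 ∈ C; rw [elt_zero]; exact C.zero_mem
      smul_mem' := by
        intro p e he
        have := C.mul_mem_left (ι p) he
        rwa [mul_elt, mul_zero] at this }
  have hCE : ∀ {e x}, elt ι y e x ∈ C → e * E = e ∧ x * E = x := by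
    intro e x hex
    have := hC _ hex
    rw [mul_elt] at this
    simpa only [mul_comm E] using d.elt_inj this
  obtain ⟨a, has, hI⟩ := h.exists_eq_level (I := I) fun x ⟨e, he⟩ => (hCE he).2
  obtain ⟨b, hbs, hJ⟩ := h.exists_eq_level (I := J) fun x he => (hCE he).1
  have memI : ∀ x, x ∈ level t E a ↔ ∃ e, elt ι y e x ∈ C := fun x => by rw [← hI]; rfl
  have memJ : ∀ e, e ∈ level t E b ↔ elt ι y e 0 ∈ C := fun e => by rw [← hJ]; rfl
  have self : ∀ i, t ^ i * E ∈ level t E i := fun i => mem_level.2 ⟨1, by ring⟩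
  have hb := (memJ _).1 (self b)
  obtain ⟨e₀, he₀⟩ := (memI _).1 (self a)
  have key : ∀ u, elt ι y (t ^ a * E * u) (t ^ a * E) ∈ C → C = codeA ι y t E a b u := by
    intro u hu
    refine le_antisymm (fun z hz => ?_) (Ideal.span_le.2 ?_)
    · obtain ⟨e, x, rfl⟩ := d.exists_elt z
      obtain ⟨f, hf⟩ := mem_level.1 ((memI x).2 ⟨e, hz⟩)
      have h1 := sub_mem hz (C.mul_mem_left (ι f) hu)
      rw [mul_elt, elt_sub, show x - f * (t ^ a * E) = 0 by rw [hf]; ring, ← memJ] at h1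
      obtain ⟨g, hg⟩ := mem_level.1 h1
      have h2 : elt ι y e x =
          ι f * elt ι y (t ^ a * E * u) (t ^ a * E) + ι g * elt ι y (t ^ b * E) 0 := by
        rw [mul_elt, mul_elt, elt_add]
        congr 1
        · linear_combination hg
        · rw [hf]; ring
      rw [h2]
      exact add_mem (Ideal.mul_mem_left _ _ (Ideal.subset_span (by simp)))
        (Ideal.mul_mem_left _ _ (Ideal.subset_span (by simp)))
    · rintro z (rfl | rfl)
      exacts [hu, hb]
  -- Multiplication by `y` exchanges the two coefficients, so `e₀` is a multiple of `t ^ a E`.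
  have he₀a : e₀ ∈ level t E a := by
    have h1 := C.mul_mem_left y he₀
    rw [d.y_mul_elt] at h1
    have := conj_mem_level hσt hσE ((memI _).2 ⟨_, h1⟩)
    rwa [d.invol] at this
  have hab : a ≤ b := by
    have h1 := C.mul_mem_left y hb
    rw [d.y_mul_elt] at h1
    have h2 := (memI _).2 ⟨_, h1⟩
    have h3 := conj_mem_level hσt hσE h2
    rw [d.invol] at h3
    obtain ⟨f, hf⟩ := mem_level.1 h3
    have h4 : t ^ (s - a + b) * E = 0 := by
      rw [pow_add, mul_assoc, hf, ← mul_assoc, ← mul_assoc, ← pow_add, Nat.sub_add_cancel has,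
        mul_right_comm, h.pow_mul, zero_mul]
    have := h.pow_mul_eq_zero_iff.1 h4
    omega
  obtain ⟨u₀, hu₀⟩ := mem_level.1 he₀a
  obtain rfl | hlt := hab.eq_or_lt
  · refine Or.inl ⟨a, has, key 0 ?_⟩
    have h1 := sub_mem he₀ ((memJ _).1 he₀a)
    rwa [elt_sub, sub_self, sub_zero, ← mul_zero (t ^ a * E)] at h1
  · refine Or.inr ⟨a, b, u₀ * E, hlt, hbs, by rw [mul_assoc, h.idem], ?_⟩
    have hu : elt ι y (t ^ a * E * (u₀ * E)) (t ^ a * E) ∈ C := by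
      rwa [show t ^ a * E * (u₀ * E) = e₀ by rw [hu₀]; linear_combination t ^ a * u₀ * h.idem]
    have huu : E - u₀ * E * σ (u₀ * E) ∈ level t E (b - a) := by
      refine h.mem_level_of_pow_mul_mem ?_ hab hbs ((memJ _).2 ?_)
      · linear_combination (1 - σ (u₀ * E) * u₀) * h.idem
      · have h1 := C.mul_mem_left y hu
        have h2 := sub_mem h1 (C.mul_mem_left (ι (σ (u₀ * E))) hu)
        rw [d.y_mul_elt, mul_elt, elt_sub] at h2
        simp only [map_mul, map_pow, hσt, hσE] at h2 ⊢
        convert h2 using 2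
        · linear_combination (t ^ a * u₀ * E * σ u₀) * h.idem
        · ring
    refine ⟨?_, huu, key _ hu⟩
    obtain ⟨v, hv⟩ | ⟨c, hc⟩ := h.unit_or u₀
    · exact ⟨v * E, by rw [mul_assoc, h.idem], by linear_combination hv + u₀ * v * h.idem⟩
    · -- If `u` were in the maximal ideal, so would be `E`.
      exfalso
      obtain ⟨f, hf⟩ := mem_level.1 (level_anti t E (show 1 ≤ b - a by omega) huu)
      have hE1 : E ∈ level t E 1 := by
        refine mem_level.2 ⟨f + c * σ (u₀ * E), ?_⟩
        linear_combination hf + σ (u₀ * E) * hc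
      obtain ⟨f, hf⟩ := mem_level.1 hE1
      have h4 : t ^ (s - 1 + 0) * E = 0 := by
        rw [hf, add_zero, ← mul_assoc, ← mul_assoc, ← pow_add, Nat.sub_add_cancel (by omega),
          mul_right_comm, h.pow_mul, zero_mul]
      have := h.pow_mul_eq_zero_iff.1 h4
      omega

end SelfConjugate

end IsDihedralExt

end DihedralExtension

end DihedralCode

/-! ### Left ideals in a block with two exchanged idempotents -/

namespace DihedralCode

section DihedralExtension

variable {S B : Type*} [CommRing S] [Ring B]

namespace IsDihedralExt

variable {ι : S →+* B} {σ : S →+* S} {y : B} (d : IsDihedralExt ι σ y)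
  {t E : S} {s : ℕ} (h : IsChainIdem t E s) (hσt : σ t = t)
include d h hσt

section SwappedPair

variable (hE : E * σ E = 0)
include hE

/-- The terms with `f` and `e` form the component of `z` at `E`, and those with `f'` and `e'` form
`y` times the component of `y z` at `E`. -/
theorem mem_codeB {a b c : ℕ} {α : S} (hα : α * E = α) {z : B} :
    z ∈ codeB ι σ y t E a b c α ↔
      ∃ f f', ∃ e ∈ level t E c, ∃ e' ∈ level t E c,
        z = elt ι y (t ^ a * f * E + σ (t ^ b * f' * α + e'))
          (t ^ b * f * α + e + σ (t ^ a * f' * E)) := by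
  rw [codeB, Submodule.mem_span_singleton]
  have hEσα : E * σ α = 0 := by rw [← hα, map_mul, mul_left_comm, hE, mul_zero]
  have hασE : α * σ E = 0 := by rw [← hα, mul_assoc, hE, mul_zero]
  constructor
  · rintro ⟨r, rfl⟩
    obtain ⟨p, q, rfl⟩ := d.exists_elt r
    refine ⟨p, σ q, _, mem_level.2 ⟨q, rfl⟩, _, mem_level.2 ⟨σ p, rfl⟩, ?_⟩
    rw [smul_eq_mul, d.elt_mul_elt]
    simp only [map_add, map_mul, map_pow, hσt, d.invol]
    congr 1 <;> ring
  · rintro ⟨f, f', e, he, e', he', rfl⟩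
    obtain ⟨g, rfl⟩ := mem_level.1 he
    obtain ⟨g', rfl⟩ := mem_level.1 he'
    refine ⟨elt ι y (f * E + σ g' * σ E) (g * E + σ f' * σ E), ?_⟩
    have hσE : σ E * σ E = σ E := by rw [← map_mul, h.idem]
    have hσα : σ α * σ E = σ α := by rw [← map_mul, hα]
    rw [smul_eq_mul, d.elt_mul_elt]
    simp only [map_add, map_mul, map_pow, hσt, d.invol]
    congr 1
    · linear_combination f * t ^ a * h.idem + (f * t ^ c + σ g' * t ^ a) * hE +
        σ g' * t ^ c * hσE + g * t ^ b * hEσα + σ f' * t ^ b * hσα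
    · linear_combination f * t ^ b * hα + σ g' * t ^ b * hασE + g * t ^ c * h.idem +
        (g * t ^ a + σ f' * t ^ c) * hE + σ f' * t ^ a * hσE

/-- The hypothesis `a + c ≤ b + s` says that the multiples of the generator without constant term
at `E` lie in `t ^ c E S y`, so that they do not enlarge the left ideal. -/
theorem card_codeB {a b c Q : ℕ} {α : S} (hs : s ≠ 0) (hQ : Nat.card (level t E 0) = Q ^ s)
    (has : a ≤ s) (hcs : c ≤ s) (hacb : a + c ≤ b + s) (hα : α * E = α) :
    Nat.card (codeB ι σ y t E a b c α) = Q ^ (2 * (2 * s - a - c)) := by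
  have hmem := @mem_codeB _ _ _ _ _ _ _ d _ _ _ h hσt hE a b c _ hα
  have hEσ : ∀ x, x * E = x → x * σ E = 0 := fun x hx => by rw [← hx, mul_assoc, hE, mul_zero]
  have hσx : ∀ x, x * E = x → σ x * E = 0 := fun x hx => by
    rw [← hx, map_mul, mul_assoc, mul_comm (σ E), hE, mul_zero]
  -- An arbitrary choice of a preimage under multiplication by `t ^ a`.
  choose! sec hsec using fun x (hx : x ∈ level t E a) => mem_level.1 hx
  have hlE : ∀ {i} (x : level t E i), (x : S) * E = x := fun x => h.mul_idem_of_mem x.2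
  let F : (level t E a × level t E c) × (level t E a × level t E c) → codeB ι σ y t E a b c α :=
    fun v => ⟨elt ι y (v.1.1 + σ (t ^ b * sec v.2.1 * α + v.2.2))
        (t ^ b * sec v.1.1 * α + v.1.2 + σ v.2.1),
      hmem.2 ⟨sec v.1.1, sec v.2.1, _, v.1.2.2, _, v.2.2.2, by
        rw [← hsec _ v.1.1.2, ← hsec _ v.2.1.2]⟩⟩
  -- The component at `E` of `x + σ x'` recovers `x`, and likewise for `x'`.
  have split : ∀ {x x' z z' : S}, x * E = x → x' * E = x' → z * E = z → z' * E = z' →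
      x + σ x' = z + σ z' → x = z ∧ x' = z' := by
    intro x x' z z' hx hx' hz hz' hxz
    have h1 : x = z := by
      linear_combination E * hxz - hx + hz - hσx _ hx' + hσx _ hz'
    refine ⟨h1, ?_⟩
    rw [h1] at hxz
    rw [← d.invol x', ← d.invol z', add_left_cancel hxz]
  have hN : ∀ v : level t E a × level t E c,
      (t ^ b * sec v.1 * α + v.2 : S) * E = t ^ b * sec v.1 * α + v.2 := fun v => by
    rw [add_mul, hlE, mul_assoc _ α E, hα]
  have hF : Function.Bijective F := by
    constructor
    · rintro ⟨⟨x, e⟩, ⟨x', e'⟩⟩ ⟨⟨z, g⟩, ⟨z', g'⟩⟩ hv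
      obtain ⟨h1, h2⟩ := d.elt_inj (Subtype.ext_iff.1 hv)
      simp only at h1 h2
      obtain ⟨h3, h4⟩ := split (hlE _) (hN (x', e')) (hlE _) (hN (z', g')) h1
      obtain ⟨h5, h6⟩ := split (hN (x, e)) (hlE _) (hN (z, g)) (hlE _) h2
      obtain rfl := Subtype.ext h3
      obtain rfl := Subtype.ext h6
      simp only [add_right_inj] at h4 h5
      rw [Subtype.ext h4, Subtype.ext h5]
    · rintro ⟨z, hz⟩
      obtain ⟨f, f', e, he, e', he', rfl⟩ := hmem.1 hz
      have hx : ∀ f, t ^ a * f * E ∈ level t E a := fun f => mem_level.2 ⟨f, rfl⟩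
      have corr : ∀ f, t ^ b * (f - sec (t ^ a * f * E)) * α ∈ level t E c := by
        intro f
        have h1 : (f - sec (t ^ a * f * E)) * E ∈ level t E (s - a) := by
          refine h.mem_level_of_pow_mul_eq_zero (by rw [mul_assoc, h.idem]) ?_
          linear_combination hsec _ (hx f)
        obtain ⟨g, hg⟩ := mem_level.1 h1
        refine level_anti t E (show c ≤ b + (s - a) by omega) (mem_level.2 ⟨g * α, ?_⟩)
        rw [pow_add]
        linear_combination t ^ b * α * hg - t ^ b * (f - sec (t ^ a * f * E)) * hα
      refine ⟨((⟨_, hx f⟩, ⟨_, add_mem he (corr f)⟩),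
        (⟨_, hx f'⟩, ⟨_, add_mem he' (corr f')⟩)), Subtype.ext ?_⟩
      simp only [F]
      congr 1
      · congr 2; ring
      · congr 1; ring
  rw [← Nat.card_congr (Equiv.ofBijective F hF), Nat.card_prod, Nat.card_prod,
    h.card_level_of_card hs hQ has, h.card_level_of_card hs hQ hcs, ← pow_add, ← pow_add]
  congr 1
  omega

theorem exists_eq_codeB {C : Ideal B} (hC : ∀ z ∈ C, ι (E + σ E) * z = z) :
    (∃ a ≤ s, ∃ c ≤ s, C = codeB ι σ y t E a c c 0) ∨
      ∃ a b c α, a < s ∧ c ≤ s ∧ a + c ≤ b + s ∧ b < c ∧ α * E = α ∧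
        (∃ v, v * E = v ∧ α * v = E) ∧ C = codeB ι σ y t E a b c α := by
  -- `E C` is a submodule of the free module on `1`, `y` over `E S`. Its first coordinates form
  -- the ideal `I`, and the elements with first coordinate `0` form the ideal `J`.
  let I : Ideal S :=
    { carrier := {x | x * E = x ∧ ∃ e, e * E = e ∧ elt ι y x e ∈ C}
      add_mem' := by
        rintro x x' ⟨hx, e, heE, he⟩ ⟨hx', e', heE', he'⟩
        exact ⟨by rw [add_mul, hx, hx'], e + e', by rw [add_mul, heE, heE'],
          by rw [← elt_add]; exact C.add_mem he he'⟩
      zero_mem' := ⟨zero_mul _, 0, zero_mul _, by rw [elt_zero]; exact C.zero_mem⟩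
      smul_mem' := by
        rintro p x ⟨hx, e, heE, he⟩
        exact ⟨by rw [smul_eq_mul, mul_assoc, hx], p * e, by rw [mul_assoc, heE],
          by rw [smul_eq_mul, ← mul_elt]; exact C.mul_mem_left _ he⟩ }
  let J : Ideal S :=
    { carrier := {e | e * E = e ∧ elt ι y 0 e ∈ C}
      add_mem' := by
        rintro e e' ⟨heE, he⟩ ⟨heE', he'⟩
        refine ⟨by rw [add_mul, heE, heE'], ?_⟩
        have := C.add_mem he he'
        rwa [elt_add, add_zero] at this
      zero_mem' := ⟨zero_mul _, by rw [elt_zero]; exact C.zero_mem⟩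
      smul_mem' := by
        rintro p e ⟨heE, he⟩
        refine ⟨by rw [smul_eq_mul, mul_assoc, heE], ?_⟩
        have := C.mul_mem_left (ι p) he
        rwa [mul_elt, mul_zero] at this }
  obtain ⟨a, has, hI⟩ := h.exists_eq_level (I := I) fun x hx => hx.1
  obtain ⟨c, hcs, hJ⟩ := h.exists_eq_level (I := J) fun x hx => hx.1
  have memI : ∀ x, x ∈ level t E a ↔ x * E = x ∧ ∃ e, e * E = e ∧ elt ι y x e ∈ C :=
    fun x => by rw [← hI]; rfl
  have memJ : ∀ e, e ∈ level t E c ↔ e * E = e ∧ elt ι y 0 e ∈ C := fun e => by rw [← hJ]; rfl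
  have self : ∀ i, t ^ i * E ∈ level t E i := fun i => mem_level.2 ⟨1, by ring⟩
  obtain ⟨-, hc⟩ := (memJ _).1 (self c)
  obtain ⟨-, e₀, he₀E, he₀⟩ := (memI _).1 (self a)
  have key : ∀ b α, α * E = α → elt ι y (t ^ a * E) (t ^ b * α) ∈ C →
      C = codeB ι σ y t E a b c α := by
    intro b α hα hab
    refine le_antisymm (fun z hz => ?_) ?_
    · have comp : ∀ z ∈ C, ∃ f, ∃ e ∈ level t E c,
          ι E * z = elt ι y (t ^ a * f * E) (t ^ b * f * α + e) := by
        intro z hz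
        obtain ⟨x, w, rfl⟩ := d.exists_elt z
        have h1 := C.mul_mem_left (ι E) hz
        rw [mul_elt] at h1 ⊢
        have hxE : E * x * E = E * x := by linear_combination x * h.idem
        have hwE : E * w * E = E * w := by linear_combination w * h.idem
        obtain ⟨f, hf⟩ := mem_level.1 ((memI (E * x)).2 ⟨hxE, E * w, hwE, h1⟩)
        refine ⟨f, E * w - t ^ b * f * α, (memJ _).2 ⟨?_, ?_⟩, ?_⟩
        · linear_combination hwE - t ^ b * f * hα
        · have h2 := C.sub_mem h1 (C.mul_mem_left (ι f) hab)
          rw [mul_elt, elt_sub] at h2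
          convert h2 using 2
          · rw [hf]; ring
          · ring
        · rw [hf]; congr 1; ring
      obtain ⟨f, e, he, h1⟩ := comp z hz
      obtain ⟨f', e', he', h2⟩ := comp _ (C.mul_mem_left y hz)
      refine (d.mem_codeB h hσt hE hα).2 ⟨f, f', e, he, e', he', ?_⟩
      have h3 := congrArg (y * ·) h2
      simp only [← mul_assoc, d.y_mul, d.y_mul_elt] at h3
      rw [mul_assoc (ι (σ E)), d.y_sq, mul_one] at h3
      rw [← hC z hz, map_add, add_mul, h1, h3, elt_add]
    · rw [codeB, Ideal.span_singleton_le_iff_mem]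
      have h1 := C.mul_mem_left y hc
      rw [d.y_mul_elt, map_mul, map_pow, hσt, map_zero] at h1
      have h2 := C.add_mem hab h1
      rwa [elt_add, add_zero] at h2
  by_cases he₀c : e₀ ∈ level t E c
  · refine Or.inl ⟨a, has, c, hcs, key c 0 (zero_mul _) ?_⟩
    have h1 := C.sub_mem he₀ ((memJ _).1 he₀c).2
    rwa [elt_sub, sub_zero, sub_self, ← mul_zero (t ^ c)] at h1
  · obtain ⟨b, hbs, α, v, heα, hαE, hvE, hαv⟩ := h.exists_eq_pow_mul_unit e₀
    rw [he₀E] at heα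
    have hbc : b < c := by
      by_contra hcb
      exact he₀c (level_anti t E (not_lt.1 hcb)
        (mem_level.2 ⟨α, by rw [heα, mul_assoc, hαE]⟩))
    rw [heα] at he₀
    refine Or.inr ⟨a, b, c, α, ?_, hcs, ?_, hbc, hαE, ⟨v, hvE, hαv⟩, key b α hαE he₀⟩
    · refine has.lt_of_ne fun hs => he₀c ((memJ _).2 ⟨he₀E, ?_⟩)
      rwa [hs, h.pow_mul, ← heα] at he₀
    · -- Multiply the generator by `t ^ (s - a)`, which kills the first coordinate.
      have h1 := C.mul_mem_left (ι (t ^ (s - a) * v)) he₀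
      have hs0 : t ^ (s - a) * t ^ a = t ^ s := by rw [← pow_add, Nat.sub_add_cancel has]
      rw [mul_elt, show t ^ (s - a) * v * (t ^ a * E) = 0 by
          linear_combination v * E * hs0 + v * h.pow_mul,
        show t ^ (s - a) * v * (t ^ b * α) = t ^ (s - a + b) * E by
          rw [pow_add]; linear_combination t ^ (s - a) * t ^ b * hαv] at h1
      obtain ⟨g, hg⟩ := mem_level.1 ((memJ _).2 ⟨by rw [mul_assoc, h.idem], h1⟩)
      have h4 : t ^ (s - c + (s - a + b)) * E = 0 := by
        rw [pow_add, mul_assoc, hg, ← mul_assoc, ← mul_assoc, ← pow_add,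
          Nat.sub_add_cancel hcs, mul_right_comm, h.pow_mul, zero_mul]
      have := h.pow_mul_eq_zero_iff.1 h4
      omega

end SwappedPair

end IsDihedralExt

end DihedralExtension

end DihedralCode

/-! ### Hensel lifting and cardinalities -/

namespace DihedralCode

section Lifting

variable {R : Type*} [CommRing R] [IsLocalRing R] {γ : R}
  (hγ : IsLocalRing.maximalIdeal R = Ideal.span {γ})
include hγ

theorem C_dvd_of_map_residue_eq_zero {p : R[X]} (hp : p.map (IsLocalRing.residue R) = 0) :
    C γ ∣ p := by
  refine (C_dvd_iff_dvd_coeff _ _).2 fun i => ?_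
  have h : IsLocalRing.residue R (p.coeff i) = 0 := by rw [← coeff_map, hp, coeff_zero]
  rw [IsLocalRing.residue_eq_zero_iff, hγ] at h
  exact Ideal.mem_span_singleton.1 h

/-- Hensel lifting of a coprime factorization, when the maximal ideal is nilpotent. Only the first
factor is kept monic of constant degree, which is enough to recover the second by division. -/
theorem exists_factor_lift {s : ℕ} (hs : γ ^ s = 0) {f : R[X]}
    {P Q : (IsLocalRing.ResidueField R)[X]} (hP : P.Monic) (hPQ : IsCoprime P Q)
    (hf : f.map (IsLocalRing.residue R) = P * Q) :
    ∃ a b : R[X], a.Monic ∧ a.natDegree = P.natDegree ∧ f = a * b := by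
  have hsurj := map_surjective _ (IsLocalRing.residue_surjective (R := R))
  suffices H : ∀ i, ∃ a b : R[X], a.Monic ∧ a.map (IsLocalRing.residue R) = P ∧
      b.map (IsLocalRing.residue R) = Q ∧ C γ ^ i ∣ f - a * b by
    obtain ⟨a, b, ha, haP, -, hab⟩ := H s
    rw [← C_pow, hs, C_0, zero_dvd_iff, sub_eq_zero] at hab
    exact ⟨a, b, ha, by rw [← haP, ha.natDegree_map], hab⟩
  intro i
  induction i with
  | zero =>
    obtain ⟨a, haP, -, ha⟩ := lifts_and_natDegree_eq_and_monic
      ((mem_lifts P).2 (hsurj P)) hP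
    obtain ⟨b, hb⟩ := hsurj Q
    exact ⟨a, b, ha, haP, hb, by simp⟩
  | succ i ih =>
    obtain ⟨a, b, ha, haP, hbQ, e, he⟩ := ih
    obtain ⟨U, V, hUV⟩ := hPQ
    obtain ⟨u, rfl⟩ := hsurj U
    obtain ⟨v, rfl⟩ := hsurj V
    obtain ⟨c, hc⟩ : C γ ∣ u * a + v * b - 1 := C_dvd_of_map_residue_eq_zero hγ (by
      simp [haP, hbQ, hUV])
    -- The corrections `C γ ^ i * x` and `C γ ^ i * z` solve `x b + z a = e` modulo `γ`, and `x`
    -- is reduced modulo `a` in order to keep the first factor monic.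
    set x := (v * e) %ₘ a with hx
    have hdiv : x + a * ((v * e) /ₘ a) = v * e := modByMonic_add_div (v * e) a
    set z := u * e + (v * e) /ₘ a * b with hz
    obtain hi | hi := Nat.eq_zero_or_pos i
    · subst hi
      have h0 : C γ ∣ f - a * b := C_dvd_of_map_residue_eq_zero hγ (by simp [haP, hbQ, hf])
      exact ⟨a, b, ha, haP, hbQ, by simpa using h0⟩
    · have hres : (C γ ^ i).map (IsLocalRing.residue R) = 0 := by
        have hγ0 : IsLocalRing.residue R γ = 0 := by
          rw [IsLocalRing.residue_eq_zero_iff, hγ]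
          exact Ideal.mem_span_singleton_self γ
        rw [Polynomial.map_pow, map_C, hγ0, C_0, zero_pow hi.ne']
      refine ⟨a + C γ ^ i * x, b + C γ ^ i * z, ?_, ?_, ?_, ?_⟩
      · refine ha.add_of_left ?_
        rw [← C_pow, C_mul']
        exact (degree_smul_le _ _).trans_lt (degree_modByMonic_lt _ ha)
      · rw [Polynomial.map_add, Polynomial.map_mul, hres, zero_mul, add_zero, haP]
      · rw [Polynomial.map_add, Polynomial.map_mul, hres, zero_mul, add_zero, hbQ]
      · have hii : C γ ^ (i + i) = C γ ^ (i + 1) * C γ ^ (i - 1) := by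
          rw [← pow_add]; congr 1; omega
        refine ⟨-(c * e) - C γ ^ (i - 1) * (x * z), ?_⟩
        rw [pow_add] at hii
        linear_combination he - C γ ^ i * b * hdiv - C γ ^ i * e * hc - x * z * hii -
          C γ ^ i * a * hz

theorem irreducible_map_residue {s : ℕ} (hs : γ ^ s = 0) {f : R[X]} (hf : f.Monic)
    (hirr : Irreducible f) (hsep : (f.map (IsLocalRing.residue R)).Separable) :
    Irreducible (f.map (IsLocalRing.residue R)) := by
  have hm := hf.map (IsLocalRing.residue R)
  have hdeg := hf.natDegree_map (IsLocalRing.residue R)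
  refine (hm.irreducible_iff_natDegree).2 ⟨fun h1 => hirr.not_isUnit ?_, fun P Q hP hQ hPQ => ?_⟩
  · rw [h1, natDegree_one] at hdeg
    rw [hf.natDegree_eq_zero.1 hdeg.symm]
    exact isUnit_one
  · rw [← hPQ] at hsep
    obtain ⟨a, b, ha, hadeg, hab⟩ := exists_factor_lift hγ hs hP hsep.isCoprime hPQ.symm
    have hb : b.Monic := ha.of_mul_monic_left (hab ▸ hf)
    have hd : P.natDegree + Q.natDegree = P.natDegree + b.natDegree := by
      rw [← hP.natDegree_mul hQ, hPQ, hdeg, hab, ha.natDegree_mul hb, hadeg]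
    obtain h | h := hirr.isUnit_or_isUnit hab
    · left; rw [← hadeg, ha.eq_one_of_isUnit h, natDegree_one]
    · right; rw [Nat.add_left_cancel hd, hb.eq_one_of_isUnit h, natDegree_one]

end Lifting

section Card

variable {R : Type*} [CommRing R]

theorem card_quotient_span_monic [Nontrivial R] {f : R[X]} (hf : f.Monic) :
    Nat.card (R[X] ⧸ Ideal.span {f}) = Nat.card R ^ f.natDegree := by
  have hfin := finrank_quotient_span_eq_natDegree' hf
  have := hf.free_quotient
  have := hf.finite_quotient
  rw [Nat.card_congr (Module.finBasis R (R[X] ⧸ Ideal.span {f})).equivFun.toEquiv, Nat.card_fun,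
    Nat.card_fin, hfin]

theorem card_eq_pow_card_residueField [IsLocalRing R] {γ : R} {s : ℕ}
    (hγ : IsLocalRing.maximalIdeal R = Ideal.span {γ}) (hs : γ ^ s = 0)
    (hs' : ∀ i < s, γ ^ i ≠ 0) :
    Nat.card R = Nat.card (IsLocalRing.ResidueField R) ^ s := by
  have h : IsChainIdem γ 1 s := by
    refine ⟨one_mul 1, by rw [hs, zero_mul], fun m hm => by rw [mul_one]; exact hs' m hm, ?_⟩
    intro a
    by_cases ha : IsUnit a
    · obtain ⟨v, hv⟩ := ha.exists_right_inv
      exact Or.inl ⟨v, by rw [hv, one_mul]⟩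
    · have : a ∈ Ideal.span {γ} := by rw [← hγ]; exact (IsLocalRing.mem_maximalIdeal a).2 ha
      obtain ⟨c, hc⟩ := Ideal.mem_span_singleton.1 this
      exact Or.inr ⟨c, by rw [hc]⟩
  have h0 : level γ (1 : R) 0 = ⊤ := by rw [level, pow_zero, one_mul, Ideal.span_singleton_one]
  have h1 : level γ (1 : R) 1 = IsLocalRing.maximalIdeal R := by
    rw [level, pow_one, mul_one, hγ]
  have h2 := h.card_level (Nat.zero_le s)
  rw [h0, h1, Nat.sub_zero, Submodule.top_toAddSubgroup, AddSubgroup.relIndex_top_right] at h2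
  rw [← Nat.card_congr (Submodule.topEquiv (R := R) (M := R)).toEquiv, h2]
  rfl

end Card

end DihedralCode

/-! ### Components of `R[x] / (x ^ n - 1)` -/

namespace DihedralCode

section Cyclic

variable {R : Type*} [CommRing R] {n : ℕ}

theorem toS_eq_zero_iff {p : R[X]} : toS n p = 0 ↔ X ^ n - 1 ∣ p := by
  rw [toS, Ideal.Quotient.eq_zero_iff_mem, Ideal.mem_span_singleton]

theorem toS_surjective (a : CycRing R n) : ∃ p : R[X], toS n p = a :=
  Ideal.Quotient.mk_surjective a

theorem algebraMap_eq_toS_C (c : R) : algebraMap R (CycRing R n) c = toS n (C c) := rfl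

theorem mul_cofactor {f : R[X]} (hf : f.Monic) (hfn : f ∣ X ^ n - 1) :
    f * cofactor n f = X ^ n - 1 := by
  have := modByMonic_add_div (X ^ n - 1) f
  rwa [(modByMonic_eq_zero_iff_dvd hf).2 hfn, zero_add] at this

/-- The ideal generated by the cofactor of `f` is the annihilator of `f`. -/
theorem mem_component_iff {f : R[X]} (hf : f.Monic) (hfn : f ∣ X ^ n - 1) {a : CycRing R n} :
    a ∈ component n f ↔ toS n f * a = 0 := by
  have hd := mul_cofactor hf hfn
  rw [component, Ideal.mem_span_singleton]
  constructor
  · rintro ⟨b, rfl⟩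
    rw [← mul_assoc, toS, toS, ← map_mul, hd, ← toS, toS_eq_zero_iff.2 dvd_rfl, zero_mul]
  · intro h
    obtain ⟨p, rfl⟩ := toS_surjective a
    rw [toS, toS, ← map_mul, ← toS, toS_eq_zero_iff, ← hd] at h
    obtain ⟨c, hc⟩ := h
    have : p = cofactor n f * c := hf.isRegular.left (by simp only; rw [hc, mul_assoc])
    exact ⟨toS n c, by rw [this, toS, toS, toS, map_mul]⟩

/-- `f` is a monic factor of `x ^ n - 1` that is coprime to its cofactor, so that `idem n f` is the
identity of `component n f` and not the default value `0`. -/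
structure IsCoprimeFactor (n : ℕ) (f : R[X]) : Prop where
  monic : f.Monic
  dvd : f ∣ X ^ n - 1
  coprime : IsCoprime (cofactor n f) f

namespace IsCoprimeFactor

variable {f g : R[X]}

theorem idem_mem (hf : IsCoprimeFactor n f) : idem n f ∈ component n f :=
  (idem_spec hf.monic hf.dvd hf.coprime).1

theorem toS_mul_idem (hf : IsCoprimeFactor n f) : toS n f * idem n f = 0 :=
  (mem_component_iff hf.monic hf.dvd).1 hf.idem_mem

theorem mem_component_iff_mul_idem (hf : IsCoprimeFactor n f) {a : CycRing R n} :
    a ∈ component n f ↔ a * idem n f = a := by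
  refine ⟨fun ha => ?_, fun ha => ?_⟩
  · rw [mul_comm]; exact (idem_spec hf.monic hf.dvd hf.coprime).2 a ha
  · rw [← ha]; exact Ideal.mul_mem_left _ _ hf.idem_mem

theorem idem_mul_idem (hf : IsCoprimeFactor n f) : idem n f * idem n f = idem n f :=
  hf.mem_component_iff_mul_idem.1 hf.idem_mem

theorem exists_idem_eq (hf : IsCoprimeFactor n f) :
    ∃ a b : R[X], idem n f = toS n (a * cofactor n f) ∧ a * cofactor n f + b * f = 1 := by
  rw [idem, dif_pos hf.coprime]
  obtain ⟨b, hb⟩ := hf.coprime.choose_spec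
  exact ⟨_, b, rfl, hb⟩

theorem exists_one_sub_idem_eq (hf : IsCoprimeFactor n f) :
    ∃ b : R[X], 1 - idem n f = toS n b * toS n f := by
  obtain ⟨a, b, h1, h2⟩ := hf.exists_idem_eq
  refine ⟨b, ?_⟩
  have h3 : toS n (a * cofactor n f) + toS n b * toS n f = 1 := by
    rw [toS, toS, toS, ← map_mul, ← map_add, h2, map_one]
  rw [h1, ← h3]
  exact add_sub_cancel_left _ _

theorem idem_eq_of (hf : IsCoprimeFactor n f) {e : CycRing R n} (h1 : toS n f * e = 0)
    (h2 : ∀ a, toS n f * a = 0 → a * e = a) : idem n f = e := by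
  rw [← h2 _ hf.toS_mul_idem, mul_comm]
  exact hf.mem_component_iff_mul_idem.1 ((mem_component_iff hf.monic hf.dvd).2 h1)

theorem idem_mul_idem_eq_zero (hf : IsCoprimeFactor n f) (hg : IsCoprimeFactor n g)
    (h : f * g ∣ X ^ n - 1) : idem n f * idem n g = 0 := by
  obtain ⟨k, hk⟩ := h
  obtain ⟨a, -, ha, -⟩ := hf.exists_idem_eq
  have : cofactor n f = g * k := hf.monic.isRegular.left (by
    simp only; rw [mul_cofactor hf.monic hf.dvd, hk, mul_assoc])
  rw [ha, this, toS, map_mul, map_mul, mul_assoc, mul_right_comm, ← toS, ← toS,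
    hg.toS_mul_idem, zero_mul, mul_zero]

theorem idem_mul (hf : IsCoprimeFactor n f) (hg : IsCoprimeFactor n g)
    (hfg : IsCoprimeFactor n (f * g)) : idem n (f * g) = idem n f + idem n g := by
  have horth := hf.idem_mul_idem_eq_zero hg hfg.dvd
  obtain ⟨b, hb⟩ := hf.exists_one_sub_idem_eq
  obtain ⟨c, hc⟩ := hg.exists_one_sub_idem_eq
  have hm : toS n (f * g) = toS n f * toS n g := map_mul _ _ _
  refine hfg.idem_eq_of ?_ fun a ha => ?_
  · rw [hm]
    linear_combination toS n g * hf.toS_mul_idem + toS n f * hg.toS_mul_idem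
  · rw [hm] at ha
    linear_combination (-(toS n b * toS n c)) * ha + a * horth - a * (1 - idem n f) * hc -
      a * (toS n c * toS n g) * hb

theorem toS_mul_idem_eq_zero_iff (hf : IsCoprimeFactor n f) {p : R[X]} :
    toS n p * idem n f = 0 ↔ f ∣ p := by
  constructor
  · intro h
    obtain ⟨a, b, h1, h2⟩ := hf.exists_idem_eq
    rw [h1, toS, toS, ← map_mul, ← toS, toS_eq_zero_iff] at h
    have h3 : f ∣ p * (a * cofactor n f) := hf.dvd.trans h
    have h4 : p = p * (a * cofactor n f) + p * b * f := by linear_combination -p * h2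
    rw [h4]
    exact dvd_add h3 (Dvd.intro_left _ rfl)
  · rintro ⟨c, rfl⟩
    rw [toS, map_mul, mul_right_comm, ← toS, hf.toS_mul_idem, zero_mul]

theorem card_level_zero [Nontrivial R] (hf : IsCoprimeFactor n f) (t : CycRing R n) :
    Nat.card (level t (idem n f) 0) = Nat.card R ^ f.natDegree := by
  let φ : R[X] →+ CycRing R n :=
    (AddMonoidHom.mulRight (idem n f)).comp
      (Ideal.Quotient.mk (Ideal.span {(X ^ n - 1 : R[X])})).toAddMonoidHom
  have hφ : ∀ p, φ p = toS n p * idem n f := fun _ => rfl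
  have hker : φ.ker = (Ideal.span {f}).toAddSubgroup := by
    ext p
    rw [AddMonoidHom.mem_ker, hφ, hf.toS_mul_idem_eq_zero_iff, Submodule.mem_toAddSubgroup,
      Ideal.mem_span_singleton]
  have hrange : φ.range = (level t (idem n f) 0).toAddSubgroup := by
    ext a
    rw [AddMonoidHom.mem_range, Submodule.mem_toAddSubgroup, mem_level]
    constructor
    · rintro ⟨p, rfl⟩
      exact ⟨toS n p, by rw [pow_zero, one_mul, hφ]⟩
    · rintro ⟨b, rfl⟩
      obtain ⟨p, rfl⟩ := toS_surjective b
      exact ⟨p, by rw [pow_zero, one_mul, hφ]⟩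
  rw [← card_quotient_span_monic hf.monic]
  change Nat.card (level t (idem n f) 0).toAddSubgroup =
    Nat.card (R[X] ⧸ (Ideal.span {f}).toAddSubgroup)
  rw [← hrange, ← hker]
  exact (Nat.card_congr (QuotientAddGroup.quotientKerEquivRange φ).toEquiv).symm

/-- For an irreducible factor of `x ^ n - 1` the corresponding component is a chain ring. -/
theorem isChainIdem [IsLocalRing R] {γ : R} {s : ℕ} (hf : IsCoprimeFactor n f)
    (hγ : IsLocalRing.maximalIdeal R = Ideal.span {γ}) (hs : γ ^ s = 0)
    (hs' : ∀ i < s, γ ^ i ≠ 0) (hirr : Irreducible f)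
    (hsep : (f.map (IsLocalRing.residue R)).Separable) :
    IsChainIdem (algebraMap R (CycRing R n) γ) (idem n f) s := by
  have hbar := irreducible_map_residue hγ hs hf.monic hirr hsep
  refine ⟨hf.idem_mul_idem, by rw [← map_pow, hs, map_zero, zero_mul], fun m hm h0 => ?_,
    fun a => ?_⟩
  · rw [← map_pow, algebraMap_eq_toS_C, hf.toS_mul_idem_eq_zero_iff] at h0
    have hdeg : 0 < f.degree := by
      rw [← natDegree_pos_iff_degree_pos, ← hf.monic.natDegree_map (IsLocalRing.residue R)]
      exact hbar.natDegree_pos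
    have h1 := (modByMonic_eq_zero_iff_dvd hf.monic).2 h0
    rw [(modByMonic_eq_self_iff hf.monic).2 (degree_C_le.trans_lt hdeg), C_eq_zero] at h1
    exact hs' m hm h1
  · obtain ⟨p, rfl⟩ := toS_surjective a
    have hsurj := map_surjective _ (IsLocalRing.residue_surjective (R := R))
    obtain hdvd | hcop := dvd_or_isCoprime _ (p.map (IsLocalRing.residue R)) hbar
    · obtain ⟨H, hH⟩ := hdvd
      obtain ⟨k, rfl⟩ := hsurj H
      obtain ⟨c, hc⟩ : C γ ∣ p - f * k := C_dvd_of_map_residue_eq_zero hγ (by simp [hH])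
      refine Or.inr ⟨toS n c, ?_⟩
      have h1 : toS n p - toS n f * toS n k = toS n (C γ) * toS n c := by
        simpa only [toS, map_sub, map_mul] using congrArg (toS n) hc
      rw [algebraMap_eq_toS_C]
      linear_combination idem n f * h1 + toS n k * hf.toS_mul_idem
    · obtain ⟨U, V, hUV⟩ := hcop
      obtain ⟨u, rfl⟩ := hsurj U
      obtain ⟨v, rfl⟩ := hsurj V
      obtain ⟨c, hc⟩ : C γ ∣ u * f + v * p - 1 := C_dvd_of_map_residue_eq_zero hγ (by simp [hUV])
      have h1 : toS n u * toS n f + toS n v * toS n p - 1 = toS n (C γ) * toS n c := by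
        simpa only [toS, map_sub, map_add, map_mul, map_one] using congrArg (toS n) hc
      have hnil : IsNilpotent (toS n (C γ) * toS n c) :=
        Commute.isNilpotent_mul_right (Commute.all _ _)
          ⟨s, by rw [← algebraMap_eq_toS_C, ← map_pow, hs, map_zero]⟩
      obtain ⟨z, hz⟩ := hnil.isUnit_one_add.exists_right_inv
      refine Or.inl ⟨toS n v * z, ?_⟩
      linear_combination z * idem n f * h1 + idem n f * hz - z * toS n u * hf.toS_mul_idem

end IsCoprimeFactor

end Cyclic

section Conjugation

variable {R : Type*} [CommRing R] {n : ℕ}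

theorem toS_eq_aeval (p : R[X]) : toS n p = aeval (toS n (X : R[X])) p := by
  have : (Ideal.Quotient.mkₐ R (Ideal.span {(X ^ n - 1 : R[X])})) =
      aeval (toS n (X : R[X])) := by
    ext; simp
  exact congrArg (fun φ : R[X] →ₐ[R] CycRing R n => φ p) this

theorem conj_toS (p : R[X]) : conj n (toS n p) = aeval (toS n (X : R[X]) ^ (n - 1)) p := rfl

theorem toS_X_mul_pow (hn : n ≠ 0) : toS n (X : R[X]) * toS n (X : R[X]) ^ (n - 1) = 1 := by
  rw [mul_pow_sub_one hn, toS_X_pow]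

theorem conj_conj (hn : n ≠ 0) (a : CycRing R n) : conj n (conj n a) = a := by
  obtain ⟨p, rfl⟩ := toS_surjective a
  have hX : conj n (toS n (X : R[X])) = toS n (X : R[X]) ^ (n - 1) := by rw [conj_toS, aeval_X]
  have h1 := toS_X_mul_pow (R := R) hn
  -- Both sides are the inverse of `x ^ (n - 1)`.
  have h2 : (toS n (X : R[X]) ^ (n - 1)) ^ (n - 1) = toS n (X : R[X]) := by
    have h3 : toS n (X : R[X]) ^ (n - 1) * (toS n (X : R[X]) ^ (n - 1)) ^ (n - 1) = 1 := by
      rw [← mul_pow, h1, one_pow]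
    linear_combination toS n (X : R[X]) * h3 - (toS n (X : R[X]) ^ (n - 1)) ^ (n - 1) * h1
  rw [conj_toS, ← aeval_algHom_apply, map_pow, hX, h2]
  exact (toS_eq_aeval p).symm

theorem isUnit_coeff_zero (hn : n ≠ 0) {g : R[X]} (hgn : g ∣ X ^ n - 1) :
    IsUnit (g.coeff 0) := by
  obtain ⟨c, hc⟩ := hgn
  have := congrArg (fun p => coeff p 0) hc
  simp only [mul_coeff_zero, coeff_sub, coeff_X_pow, coeff_one_zero, if_neg hn.symm] at this
  exact IsUnit.of_mul_eq_one (-c.coeff 0) (by linear_combination this)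

theorem monic_recip [Nontrivial R] (hn : n ≠ 0) {g : R[X]} (hgn : g ∣ X ^ n - 1) :
    (recip g).Monic := by
  have hu := isUnit_coeff_zero hn hgn
  have htr : g.trailingCoeff = g.coeff 0 := by
    rw [trailingCoeff, natTrailingDegree_eq_zero.2 (Or.inr hu.ne_zero)]
  have hlc : g.reverse.leadingCoeff = g.coeff 0 := by rw [reverse_leadingCoeff, htr]
  rw [recip, Monic, leadingCoeff_mul', leadingCoeff_C, hlc, Ring.inverse_mul_cancel _ hu]
  rw [leadingCoeff_C, hlc, Ring.inverse_mul_cancel _ hu]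
  exact one_ne_zero

/-- Up to a unit of `S`, substituting `x⁻¹` in `g` gives the reciprocal polynomial. -/
theorem exists_unit_conj_toS (hn : n ≠ 0) {g : R[X]} (hgn : g ∣ X ^ n - 1) :
    ∃ v v' : CycRing R n, v * v' = 1 ∧ conj n (toS n g) = v * toS n (recip g) := by
  have hu := isUnit_coeff_zero hn hgn
  have h1 := toS_X_mul_pow (R := R) hn
  set x := toS n (X : R[X]) with hx
  let _ : Invertible (x ^ (n - 1)) := ⟨x, h1, by rw [mul_comm]; exact h1⟩
  have h2 := eval₂_reverse_mul_pow (algebraMap R (CycRing R n)) (x ^ (n - 1)) g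
  have h3 : eval₂ (algebraMap R (CycRing R n)) (⅟(x ^ (n - 1))) g.reverse = toS n g.reverse :=
    (toS_eq_aeval _).symm
  have h4 : eval₂ (algebraMap R (CycRing R n)) (x ^ (n - 1)) g = conj n (toS n g) := rfl
  rw [h3, h4] at h2
  have h5 : toS n (C (g.coeff 0)) * toS n (C (Ring.inverse (g.coeff 0))) = 1 := by
    rw [toS, toS, ← map_mul, ← C_mul, Ring.mul_inverse_cancel _ hu, C_1, map_one]
  have h6 : (x ^ (n - 1)) ^ g.natDegree * x ^ g.natDegree = 1 := by
    rw [← mul_pow, mul_comm, h1, one_pow]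
  have h7 : toS n (recip g) = toS n (C (Ring.inverse (g.coeff 0))) * toS n g.reverse :=
    map_mul _ _ _
  refine ⟨(x ^ (n - 1)) ^ g.natDegree * toS n (C (g.coeff 0)),
    x ^ g.natDegree * toS n (C (Ring.inverse (g.coeff 0))), ?_, ?_⟩
  · linear_combination
      (toS n (C (g.coeff 0)) * toS n (C (Ring.inverse (g.coeff 0)))) * h6 + h5
  · rw [← h2, h7]
    linear_combination (-(toS n g.reverse * (x ^ (n - 1)) ^ g.natDegree)) * h5

theorem conj_idem (hn : n ≠ 0) {g : R[X]} (hg : IsCoprimeFactor n g)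
    (hg' : IsCoprimeFactor n (recip g)) : conj n (idem n g) = idem n (recip g) := by
  obtain ⟨v, v', hv, hvg⟩ := exists_unit_conj_toS hn hg.dvd
  refine (hg'.idem_eq_of ?_ fun a ha => ?_).symm
  · have h1 := congrArg (conj n) hg.toS_mul_idem
    rw [map_mul, map_zero, hvg] at h1
    linear_combination v' * h1 - toS n (recip g) * conj n (idem n g) * hv
  · have h2 : conj n a ∈ component n g := by
      refine (mem_component_iff hg.monic hg.dvd).2 ?_
      rw [← conj_conj hn (toS n g), ← map_mul, hvg, mul_assoc, ha, mul_zero, map_zero]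
    have h3 := congrArg (conj n) (hg.mem_component_iff_mul_idem.1 h2)
    rwa [map_mul, conj_conj hn] at h3

end Conjugation

end DihedralCode

/-! ### The dihedral group ring and its central idempotents -/

namespace DihedralCode

section GroupRing

variable {R : Type*} [CommRing R] {n : ℕ}

theorem emb_toS (p : R[X]) : emb n (toS n p) = aeval (genX R n) p := rfl

theorem genY_mul_emb (hn : n ≠ 0) (a : CycRing R n) :
    genY R n * emb n a = emb n (conj n a) * genY R n := by
  have hX : SemiconjBy (genY R n) (genX R n) (genX R n ^ (n - 1)) := by
    rw [SemiconjBy]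
    nth_rw 2 [← genX_genY_genX]
    rw [← mul_assoc, pow_sub_one_mul hn, genX_pow, one_mul]
  obtain ⟨p, rfl⟩ := toS_surjective a
  induction p using Polynomial.induction_on' with
  | add p q hp hq =>
    simp only [toS, map_add, mul_add, add_mul] at hp hq ⊢
    rw [hp, hq]
  | monomial k c =>
    rw [conj_toS, emb_toS, aeval_monomial, aeval_monomial, map_mul, map_pow, map_pow, emb_toS,
      aeval_X, AlgHom.commutes, mul_assoc, ← (hX.pow_right k).eq, ← mul_assoc, ← mul_assoc,
      Algebra.commutes]

theorem exists_emb_add_emb_mul (hn : n ≠ 0) (z : DihRing R n) :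
    ∃ a b : CycRing R n, z = emb n a + emb n b * genY R n := by
  have : NeZero n := ⟨hn⟩
  have hr : ∀ i : ZMod n, MonoidAlgebra.of R _ (DihedralGroup.r i) =
      emb n (toS n (X : R[X]) ^ i.val) := by
    intro i
    rw [map_pow, emb_toS, aeval_X, genX, ← map_pow, DihedralGroup.r_one_pow, ZMod.natCast_zmod_val]
  induction z using MonoidAlgebra.induction_on with
  | of g =>
    cases g with
    | r i => exact ⟨toS n (X : R[X]) ^ i.val, 0, by rw [hr, map_zero, zero_mul, add_zero]⟩
    | sr i =>
      refine ⟨0, conj n (toS n (X : R[X]) ^ i.val), ?_⟩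
      rw [map_zero, zero_add, ← genY_mul_emb hn, ← hr, genY, ← map_mul, DihedralGroup.sr_mul_r,
        zero_add]
  | add z w hz hw =>
    obtain ⟨a, b, rfl⟩ := hz
    obtain ⟨a', b', rfl⟩ := hw
    exact ⟨a + a', b + b', by simp only [map_add, add_mul]; abel⟩
  | smul c z hz =>
    obtain ⟨a, b, rfl⟩ := hz
    exact ⟨c • a, c • b, by simp only [map_smul, smul_add, smul_mul_assoc]⟩

theorem isDihedralExt [Finite R] [Nontrivial R] (hn : n ≠ 0) :
    IsDihedralExt (emb n : CycRing R n →ₐ[R] DihRing R n).toRingHom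
      (conj n : CycRing R n →ₐ[R] CycRing R n).toRingHom (genY R n) := by
  have : NeZero n := ⟨hn⟩
  refine ⟨genY_mul_emb hn, by rw [← sq, genY_sq], conj_conj hn, ?_⟩
  -- The map is surjective between finite sets of the same size.
  have hmon : (X ^ n - 1 : R[X]).Monic := by simpa using monic_X_pow_sub_C (1 : R) hn
  have hdeg : (X ^ n - 1 : R[X]).natDegree = n := by
    simpa using natDegree_X_pow_sub_C (n := n) (r := (1 : R))
  have hcS : Nat.card (CycRing R n) = Nat.card R ^ n := by
    rw [card_quotient_span_monic hmon, hdeg]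
  have hcB : Nat.card (DihRing R n) = Nat.card R ^ (2 * n) := by
    let e : DihRing R n ≃ (DihedralGroup n → R) :=
      { toFun := fun z => z.coeff
        invFun := fun v => ⟨Finsupp.equivFunOnFinite.symm v⟩
        left_inv := fun z => by simp
        right_inv := fun v => by simp }
    rw [Nat.card_congr e, Nat.card_fun, DihedralGroup.nat_card]
  have : Finite (CycRing R n) :=
    Nat.finite_of_card_ne_zero (by rw [hcS]; exact pow_ne_zero _ Nat.card_pos.ne')
  have : Finite (DihRing R n) :=
    Nat.finite_of_card_ne_zero (by rw [hcB]; exact pow_ne_zero _ Nat.card_pos.ne')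
  refine (Nat.bijective_iff_surjective_and_card _).2 ⟨fun z => ?_, ?_⟩
  · obtain ⟨a, b, h⟩ := exists_emb_add_emb_mul hn z
    exact ⟨(a, b), h.symm⟩
  · rw [Nat.card_prod, hcS, hcB, ← pow_add, two_mul]

end GroupRing

section Idempotents

/-- A left ideal splits along a complete family of central orthogonal idempotents. -/
theorem exists_iSupIndep_of_central_idempotents {B κ : Type*} [Ring B] [Fintype κ] {F : κ → B}
    (hF : CompleteOrthogonalIdempotents F) (hcent : ∀ i z, F i * z = z * F i) (C : Ideal B) :
    ∃ D : κ → Ideal B, iSupIndep D ∧ C = ⨆ i, D i ∧ ∀ i, ∀ z ∈ D i, F i * z = z := by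
  classical
  let K : B → Ideal B := fun e => LinearMap.ker (LinearMap.toSpanSingleton B B e)
  have hK : ∀ {e z}, z ∈ K e ↔ z * e = 0 := Iff.rfl
  refine ⟨fun i => C ⊓ K (1 - F i), ?_, le_antisymm (fun z hz => ?_) (iSup_le fun i => inf_le_left),
    fun i z hz => ?_⟩
  · intro i
    refine Submodule.disjoint_def.2 fun z hz hz' => ?_
    have h1 : ⨆ j, ⨆ _ : j ≠ i, C ⊓ K (1 - F j) ≤ K (F i) := by
      refine iSup₂_le fun j hj w hw => ?_
      have hw' := hK.1 hw.2
      rw [mul_sub, mul_one, sub_eq_zero] at hw'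
      rw [hK, hw', mul_assoc, hF.ortho hj, mul_zero]
    have h2 := hK.1 hz.2
    rwa [mul_sub, mul_one, hK.1 (h1 hz'), sub_zero] at h2
  · have hsum : z = ∑ i, F i * z := by rw [← Finset.sum_mul, hF.complete, one_mul]
    rw [hsum]
    refine Submodule.sum_mem _ fun i _ => Submodule.mem_iSup_of_mem i ⟨C.mul_mem_left _ hz, ?_⟩
    refine hK.2 ?_
    rw [hcent, mul_assoc, mul_sub, mul_one, (hF.idem i).eq, sub_self, mul_zero]
  · have h2 := hK.1 hz.2
    rw [mul_sub, mul_one, sub_eq_zero] at h2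
    rw [hcent, ← h2]

variable {R : Type*} [CommRing R] {n : ℕ}

theorem completeOrthogonalIdempotents_idem {κ : Type*} [Fintype κ] {h : κ → R[X]}
    (hh : ∀ i, IsCoprimeFactor n (h i)) (hprod : ∏ i, h i = X ^ n - 1) :
    CompleteOrthogonalIdempotents fun i => idem n (h i) := by
  classical
  have horth : OrthogonalIdempotents fun i => idem n (h i) := by
    refine ⟨fun i => (hh i).idem_mul_idem, fun i j hij => ?_⟩
    refine (hh i).idem_mul_idem_eq_zero (hh j) ?_
    rw [← hprod, ← Finset.prod_pair hij]
    exact Finset.prod_dvd_prod_of_subset _ _ _ (Finset.subset_univ _)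
  refine ⟨horth, ?_⟩
  rw [← sub_eq_zero, ← neg_eq_zero, neg_sub, ← horth.prod_one_sub]
  choose b hb using fun i => (hh i).exists_one_sub_idem_eq
  simp only [hb, Finset.prod_mul_distrib]
  rw [← map_prod (Ideal.Quotient.mk _) h, hprod, ← toS, toS_eq_zero_iff.2 dvd_rfl, mul_zero]

theorem separable_X_pow_sub_one {p k : ℕ} [CharP R (p ^ k)] (hpn : Nat.Coprime p n) :
    (X ^ n - 1 : R[X]).Separable := by
  have hco : IsCoprime (n : ℤ) ((p ^ k : ℕ) : ℤ) :=
    Nat.isCoprime_iff_coprime.2 (hpn.symm.pow_right k)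
  have hn : IsCoprime (n : R) ((p ^ k : ℕ) : R) := by
    simpa only [eq_intCast, Int.cast_natCast] using hco.map (Int.castRingHom R)
  rw [CharP.cast_eq_zero R (p ^ k), isCoprime_zero_right] at hn
  simpa using separable_X_pow_sub_C_unit (1 : Rˣ) hn

end Idempotents

section Codes

variable {R : Type*} [CommRing R] {n : ℕ} (γ : R)

theorem pow_smul_eq (m : ℕ) (z : CycRing R n) :
    γ ^ m • z = algebraMap R (CycRing R n) γ ^ m * z := by
  rw [← map_pow]
  exact Algebra.smul_def (γ ^ m) z

theorem codeA2_eq (f : R[X]) (a b : ℕ) (u : CycRing R n) :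
    codeA2 γ n f a b u = codeA (emb n).toRingHom (genY R n) (algebraMap R (CycRing R n) γ)
      (idem n f) a b u := by
  have hι : ∀ x : CycRing R n, (emb n : CycRing R n →ₐ[R] DihRing R n).toRingHom x = emb n x :=
    fun _ => rfl
  simp only [codeA2, codeA, elt, hι, map_zero, zero_mul, add_zero, Algebra.smul_def, map_mul,
    map_pow, AlgHom.commutes, mul_add, mul_assoc, add_comm (genY R n)]

theorem codeA1_eq (hn : n ≠ 0) {f : R[X]} (hf : conj n (idem n f) = idem n f) (b : ℕ) :
    codeA1 γ n f b = codeA (emb n).toRingHom (genY R n) (algebraMap R (CycRing R n) γ)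
      (idem n f) b b 0 := by
  rw [← codeA2_eq, codeA1, codeA2]
  refine le_antisymm (Ideal.span_mono (by simp)) (Ideal.span_le.2 ?_)
  rintro z (rfl | rfl)
  · rw [map_zero, add_zero, ← hf, ← genY_mul_emb hn, ← mul_smul_comm, hf]
    exact Ideal.mul_mem_left _ _ (Ideal.mem_span_singleton_self _)
  · exact Ideal.mem_span_singleton_self _

theorem codeB2_eq {g : R[X]} (hg : conj n (idem n g) = idem n (recip g)) (a b c : ℕ)
    (α : CycRing R n) :
    codeB2 γ n g a b c α = codeB (emb n).toRingHom (conj n).toRingHom (genY R n)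
      (algebraMap R (CycRing R n) γ) (idem n g) a b c α := by
  have hι : ∀ x : CycRing R n, (emb n : CycRing R n →ₐ[R] DihRing R n).toRingHom x = emb n x :=
    fun _ => rfl
  have hσ : (conj n : CycRing R n →ₐ[R] CycRing R n).toRingHom (idem n g) = idem n (recip g) := hg
  simp only [codeB2, codeB, elt, hι, hσ, Algebra.smul_def, map_add, map_mul, map_pow,
    AlgHom.commutes]

theorem codeB1_eq {g : R[X]} (hg : conj n (idem n g) = idem n (recip g)) (a c : ℕ) :
    codeB1 γ n g a c = codeB (emb n).toRingHom (conj n).toRingHom (genY R n)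
      (algebraMap R (CycRing R n) γ) (idem n g) a c c 0 := by
  rw [← codeB2_eq γ hg, codeB1, codeB2, map_zero, smul_zero, zero_mul, add_zero]

end Codes

end DihedralCode

theorem theorem3p3 {R : Type*} [CommRing R] [Finite R] [IsLocalRing R]
    (hchain : ∀ I J : Ideal R, I ≤ J ∨ J ≤ I)
    (p k n : ℕ) (hp : p.Prime) [CharP R (p ^ k)] (hpn : Nat.gcd p n = 1)
    (γ : R) (hγ : IsLocalRing.maximalIdeal R = Ideal.span {γ})
    (s : ℕ) (hs : γ ^ s = 0) (hs' : ∀ i < s, γ ^ i ≠ 0)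
    (q : ℕ) (hq : q = Nat.card (IsLocalRing.ResidueField R))
    (r w : ℕ) (f : Fin r → R[X]) (g : Fin w → R[X])
    (hfg : DihedralCode.IsFactorization n f g) :
    (∀ C : Ideal (DihedralCode.DihRing R n),
      ∃ D : Fin r ⊕ Fin w → Ideal (DihedralCode.DihRing R n),
        iSupIndep D ∧ C = ⨆ i, D i ∧
        (∀ i : Fin r,
          (∃ b ≤ s, D (Sum.inl i) = DihedralCode.codeA1 γ n (f i) b) ∨
          (∃ a b u, DihedralCode.AdmissibleA2 γ s n (f i) a b u ∧
            D (Sum.inl i) = DihedralCode.codeA2 γ n (f i) a b u)) ∧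
        (∀ j : Fin w,
          (∃ a ≤ s, ∃ c ≤ s, D (Sum.inr j) = DihedralCode.codeB1 γ n (g j) a c) ∨
          (∃ a b c α, DihedralCode.AdmissibleB2 γ s n (g j) a b c α ∧
            D (Sum.inr j) = DihedralCode.codeB2 γ n (g j) a b c α))) ∧
    (∀ i : Fin r, ∀ b ≤ s,
      Nat.card (DihedralCode.codeA1 γ n (f i) b) = q ^ (2 * (f i).natDegree * (s - b))) ∧
    (∀ (i : Fin r) (a b : ℕ) (u : DihedralCode.CycRing R n),
      DihedralCode.AdmissibleA2 γ s n (f i) a b u →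
      Nat.card (DihedralCode.codeA2 γ n (f i) a b u) =
        q ^ ((f i).natDegree * (2 * s - a - b))) ∧
    (∀ j : Fin w, ∀ a ≤ s, ∀ c ≤ s,
      Nat.card (DihedralCode.codeB1 γ n (g j) a c) =
        q ^ (2 * (g j).natDegree * (2 * s - a - c))) ∧
    (∀ (j : Fin w) (a b c : ℕ) (α : DihedralCode.CycRing R n),
      DihedralCode.AdmissibleB2 γ s n (g j) a b c α →
      Nat.card (DihedralCode.codeB2 γ n (g j) a b c α) =
        q ^ (2 * (g j).natDegree * (2 * s - a - c))) := by
  have hn : n ≠ 0 := by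
    rintro rfl
    exact hp.one_lt.ne' (by rwa [Nat.gcd_zero_right] at hpn)
  have hs0 : s ≠ 0 := by
    rintro rfl
    exact one_ne_zero (by rwa [pow_zero] at hs)
  have hsep : (X ^ n - 1 : R[X]).Separable :=
    DihedralCode.separable_X_pow_sub_one (p := p) (k := k) hpn
  have hcop : ∀ {e : R[X]}, e.Monic → e ∣ X ^ n - 1 → DihedralCode.IsCoprimeFactor n e :=
    fun he hen => ⟨he, hen, DihedralCode.isCoprime_cofactor (p := p) (k := k) hpn he hen⟩
  have hfdvd : ∀ i, f i ∣ X ^ n - 1 := fun i => by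
    rw [hfg.prod_eq]
    exact (Finset.dvd_prod_of_mem f (Finset.mem_univ i)).mul_right _
  have hggdvd : ∀ j, g j * DihedralCode.recip (g j) ∣ X ^ n - 1 := fun j => by
    rw [hfg.prod_eq]
    exact (Finset.dvd_prod_of_mem (fun j => g j * DihedralCode.recip (g j))
      (Finset.mem_univ j)).mul_left _
  have hf := fun i => hcop (hfg.monic_f i) (hfdvd i)
  have hgdvd : ∀ j, g j ∣ X ^ n - 1 := fun j => (dvd_mul_right _ _).trans (hggdvd j)
  have hg := fun j => hcop (hfg.monic_g j) (hgdvd j)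
  have hrm := fun j => DihedralCode.monic_recip hn (hgdvd j)
  have hr := fun j => hcop (hrm j) ((dvd_mul_left _ _).trans (hggdvd j))
  have hgg := fun j => hcop ((hfg.monic_g j).mul (hrm j)) (hggdvd j)
  have hσf : ∀ i, DihedralCode.conj n (DihedralCode.idem n (f i)) =
      DihedralCode.idem n (f i) := fun i => by
    have := DihedralCode.conj_idem hn (hf i) (by rw [hfg.recip_f i]; exact hf i)
    rwa [hfg.recip_f i] at this
  have hσg := fun j => DihedralCode.conj_idem hn (hg j) (hr j)
  have hchf := fun i => (hf i).isChainIdem hγ hs hs' (hfg.irreducible_f i)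
    ((hsep.of_dvd (hfdvd i)).map)
  have hchg := fun j => (hg j).isChainIdem hγ hs hs' (hfg.irreducible_g j)
    ((hsep.of_dvd (hgdvd j)).map)
  have hcard : ∀ {e : R[X]}, DihedralCode.IsCoprimeFactor n e →
      Nat.card (DihedralCode.level (algebraMap R (DihedralCode.CycRing R n) γ)
        (DihedralCode.idem n e) 0) = (q ^ e.natDegree) ^ s := fun {e} he => by
    rw [he.card_level_zero, DihedralCode.card_eq_pow_card_residueField hγ hs hs', ← hq,
      ← pow_mul, ← pow_mul, mul_comm]
  have d := DihedralCode.isDihedralExt (R := R) hn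
  have hσγ : (DihedralCode.conj n : DihedralCode.CycRing R n →ₐ[R] _).toRingHom
      (algebraMap R (DihedralCode.CycRing R n) γ) = algebraMap R _ γ := AlgHom.commutes _ γ
  have horth : ∀ j, DihedralCode.idem n (g j) *
      (DihedralCode.conj n : DihedralCode.CycRing R n →ₐ[R] _).toRingHom
        (DihedralCode.idem n (g j)) = 0 := fun j =>
    (congrArg _ (hσg j)).trans ((hg j).idem_mul_idem_eq_zero (hr j) (hggdvd j))
  refine ⟨fun C => ?_, fun i b hb => ?_, fun i a b u hu => ?_, fun j a ha c hc => ?_,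
    fun j a b c α hα => ?_⟩
  · -- One block for each self-reciprocal factor and one for each reciprocal pair.
    let h : Fin r ⊕ Fin w → R[X] := Sum.elim f fun j => g j * DihedralCode.recip (g j)
    have hh : ∀ i, DihedralCode.IsCoprimeFactor n (h i) := by
      rintro (i | j)
      exacts [hf i, hgg j]
    have hF := DihedralCode.completeOrthogonalIdempotents_idem hh
      (by rw [Fintype.prod_sum_type, hfg.prod_eq]; rfl)
    have hσh : ∀ i, DihedralCode.conj n (DihedralCode.idem n (h i)) =
        DihedralCode.idem n (h i) := by
      rintro (i | j)
      · exact hσf i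
      · change DihedralCode.conj n (DihedralCode.idem n (g j * DihedralCode.recip (g j))) =
          DihedralCode.idem n (g j * DihedralCode.recip (g j))
        rw [(hg j).idem_mul (hr j) (hgg j), map_add, ← hσg j, DihedralCode.conj_conj hn, add_comm]
    obtain ⟨D, hD, hCD, hDF⟩ := DihedralCode.exists_iSupIndep_of_central_idempotents
      (hF.map (DihedralCode.emb n : DihedralCode.CycRing R n →ₐ[R] _).toRingHom)
      (fun i z => by
        obtain ⟨a, b, rfl⟩ := DihedralCode.exists_emb_add_emb_mul hn z
        change DihedralCode.emb n (DihedralCode.idem n (h i)) * _ =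
          _ * DihedralCode.emb n (DihedralCode.idem n (h i))
        rw [mul_add, add_mul, mul_assoc _ (DihedralCode.genY R n), DihedralCode.genY_mul_emb hn,
          hσh, ← mul_assoc, ← mul_assoc, ← map_mul, ← map_mul, ← map_mul, ← map_mul, mul_comm a,
          mul_comm b]) C
    refine ⟨D, hD, hCD, fun i => ?_, fun j => ?_⟩
    · obtain ⟨b, hb, hDb⟩ | ⟨a, b, u, hab, hbs, huE, ⟨v, hvE, huv⟩, huu, hDu⟩ :=
        d.exists_eq_codeA (hchf i) hσγ (hσf i) (hDF (Sum.inl i))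
      · exact Or.inl ⟨b, hb, by rw [hDb, DihedralCode.codeA1_eq γ hn (hσf i)]⟩
      · obtain ⟨z, hz⟩ := DihedralCode.mem_level.1 huu
        refine Or.inr ⟨a, b, u, ⟨hab, hbs, ⟨?_, v, ?_, huv⟩,
          -(z * DihedralCode.idem n (f i)), ?_, ?_⟩, by rw [hDu, DihedralCode.codeA2_eq]⟩
        · exact (hf i).mem_component_iff_mul_idem.2 huE
        · exact (hf i).mem_component_iff_mul_idem.2 hvE
        · exact neg_mem (Ideal.mul_mem_left _ _ (hf i).idem_mem)
        · rw [DihedralCode.pow_smul_eq]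
          change DihedralCode.idem n (f i) - u * DihedralCode.conj n u = _ at hz
          linear_combination -hz
    · obtain ⟨a, ha, c, hc, hDac⟩ | ⟨a, b, c, α, has, hcs, hacb, hbc, hαE, ⟨v, hvE, hαv⟩, hDα⟩ :=
        d.exists_eq_codeB (hchg j) hσγ (horth j) (C := D (Sum.inr j)) (fun z hz => by
          have h1 := hDF (Sum.inr j) z hz
          change DihedralCode.emb n (DihedralCode.idem n (g j * DihedralCode.recip (g j))) * z = z
            at h1
          rwa [(hg j).idem_mul (hr j) (hgg j), ← hσg j] at h1)
      · exact Or.inl ⟨a, ha, c, hc, by rw [hDac, DihedralCode.codeB1_eq γ (hσg j)]⟩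
      · refine Or.inr ⟨a, b, c, α, ⟨has, by omega, hcs, hacb, hbc, ?_, v, ?_, 0, zero_mem _, ?_⟩,
          by rw [hDα, DihedralCode.codeB2_eq γ (hσg j)]⟩
        · exact (hg j).mem_component_iff_mul_idem.2 hαE
        · exact (hg j).mem_component_iff_mul_idem.2 hvE
        · rw [hαv, smul_zero, add_zero]
  · rw [DihedralCode.codeA1_eq γ hn (hσf i), d.card_codeA (hchf i) hσγ (hσf i) hs0 (hcard (hf i))
      le_rfl hb, ← pow_mul]
    · rw [show 2 * s - b - b = 2 * (s - b) by omega]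
      congr 1
      ring
    · rw [zero_mul, sub_zero]
      exact DihedralCode.mem_level.2 ⟨1, by simp⟩
  · obtain ⟨hab, hbs, ⟨hum, -⟩, z, hz, huz⟩ := hu
    rw [DihedralCode.codeA2_eq, d.card_codeA (hchf i) hσγ (hσf i) hs0 (hcard (hf i))
      hab.le hbs, ← pow_mul]
    refine DihedralCode.mem_level.2 ⟨-z, ?_⟩
    have hzE := (hf i).mem_component_iff_mul_idem.1 hz
    rw [DihedralCode.pow_smul_eq] at huz
    change DihedralCode.idem n (f i) - u * DihedralCode.conj n u = _
    rw [huz]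
    linear_combination algebraMap R (DihedralCode.CycRing R n) γ ^ (b - a) * hzE
  · rw [DihedralCode.codeB1_eq γ (hσg j), d.card_codeB (hchg j) hσγ (horth j) hs0 (hcard (hg j))
      ha hc (by omega) (zero_mul _), ← pow_mul]
    congr 1
    ring
  · obtain ⟨has, -, hcs, hacb, -, hαm, -⟩ := hα
    rw [DihedralCode.codeB2_eq γ (hσg j), d.card_codeB (hchg j) hσγ (horth j) hs0 (hcard (hg j))
      has.le hcs hacb ((hg j).mem_component_iff_mul_idem.1 hαm), ← pow_mul]
    congr 1
    ring
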